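/- Setting. Let $n\ge 3$ and let $F(x,y)=\sum_{i=0}^n a_i x^{n-i}y^i=\prod_{k=1}^n(\beta_k x-\alpha_k y)$ be a complex binary form of degree $n$ that is stable, i.e. no linear factor of $F$ has multiplicity $\ge n/2$. Put $\|F\|=\sum_i|a_i|^2$. For $\gamma=\begin{pmatrix}a&b\\c&d\end{pmatrix}\in\mathrm{SL}(2,\mathbb C)$ let $(F\cdot\gamma)(x,y)=F(ax+by,cx+dy)$, and let $\mathrm{SL}(2,\mathbb C)$ act on hyperbolic 3-space $\mathbb H_3=\{t+uj: t\in\mathbb C,\ u>0\}$ in the standard way, $$\gamma\cdot(t+uj)=\frac{(at+b)\overline{(ct+d)}+a\bar c\,u^2+uj}{|ct+d|^2+|c|^2u^2};$$ let $\mathrm{dist}$ be the hyperbolic distance on $\mathbb H_3$. Define $$R(F,t+uj)=\prod_{k=1}^n\frac{|\alpha_k-\beta_k t|^2+|\beta_k|^2u^2}{u},$$ let $z(F)\in\mathbb H_3$ be the point at which $R(F,\cdot)$ is minimal, and let $\theta(F)=R(F,z(F))$. Let $F_0$ be a form in the $\mathrm{SL}(2,\mathbb C)$-orbit of $F$ with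 $z(F_0)=j$, and define $$\varepsilon_F(\delta)=\min_{z:\ \mathrm{dist}(z,j)=\delta}\frac{R(F_0,z)}{R(F_0,j)}\qquad(\delta\ge 0).$$ If $F$ is squarefree, write $F_0=\prod_k(\beta^0_kx-\alpha^0_ky)$ and define $$\varepsilon(F)=\inf_{\phi\in S^2,\ 0\le\rho<1}\frac{\prod_{k=1}^n(1+\langle\phi,\phi_k\rangle\rho)}{1-\rho^2},\qquad \phi_k=\left(\frac{2\alpha^0_k\overline{\beta^0_k}}{|\alpha^0_k|^2+|\beta^0_k|^2},\ \frac{|\alpha^0_k|^2-|\beta^0_k|^2}{|\alpha^0_k|^2+|\beta^0_k|^2}\right)\in S^2\subset\mathbb C\times\mathbb R=\mathbb R^3 .$$ Theorem. These objects are well defined: $R(F,\cdot)$ has a unique minimizer, $\theta(F)>0$, a form $F_0$ exists, the minimum defining $\varepsilon_F(\delta)$ is attained, $\varepsilon_F$ and (for squarefree $F$) $\varepsilon(F)$ do not depend on the choice of $F_0$, $\varepsilon_F$ is a strictly increasing bijection $[0,\infty)\to[1,\infty)$, and $\varepsilon(F)>0$ for squarefree $F$. Moreover: 1. With $\delta=\mathrm{dist}(z(F),j)$,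 $$2^{1-n}\varepsilon_F(\delta)\ \le\ \frac{\|F\|}{\theta(F)}\ \le\ 2^{-n}\binom{2n}{n}(\cosh\delta)^n .$$ 2. Let $\gamma\in\mathrm{SL}(2,\mathbb C)$ and write $\gamma^{-1}\cdot z(F)=t+uj$. If $$\frac{|t|^2+u^2+1}{2u}>\cosh\varepsilon_F^{-1}\!\left(2^{n-1}\frac{\|F\|}{\theta(F)}\right),$$ then $\|F\cdot\gamma\|>\|F\|$. 3. If $F$ is squarefree, then for every $\gamma\in\mathrm{SL}(2,\mathbb C)$, with $\gamma^{-1}\cdot z(F)=t+uj$, the condition $$\frac{|t|^2+u^2+1}{2u}>2\left(\frac{2\|F\|}{\varepsilon(F)\,\theta(F)}\right)^{1/(n-2)}$$ also implies $\|F\cdot\gamma\|>\|F\|$. -/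

import Mathlib

open scoped MatrixGroups

namespace BinaryForm

noncomputable section

/-! ### Hyperbolic three-space -/

/-- The upper half-space `ℂ × ℝ_{>0}`; the point `⟨t, u, _⟩` is written `t + u j`. -/
@[ext]
structure H3 where
  t : ℂ
  u : ℝ
  pos : 0 < u

/-- The point `j = 0 + 1 j`. -/
def H3.j : H3 := ⟨0, 1, one_pos⟩

instance : Nonempty H3 := ⟨H3.j⟩

/-- The hyperbolic distance on the upper half-space. -/
def H3.hdist (z w : H3) : ℝ :=
  Real.arcosh (1 + (‖z.t - w.t‖ ^ 2 + (z.u - w.u) ^ 2) / (2 * z.u * w.u))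

theorem H3.denom_pos (γ : SL(2, ℂ)) (z : H3) :
    0 < ‖γ 1 0 * z.t + γ 1 1‖ ^ 2 + ‖γ 1 0‖ ^ 2 * z.u ^ 2 := by
  have hu := z.pos
  by_cases hc : γ 1 0 = 0
  · have hdet := Matrix.SpecialLinearGroup.det_coe γ
    rw [Matrix.det_fin_two, hc] at hdet
    have hd : γ 1 1 ≠ 0 := by
      intro h
      rw [h] at hdet
      simp at hdet
    have := norm_pos_iff.mpr hd
    simp only [hc]
    simp
    positivity
  · have := norm_pos_iff.mpr hc
    positivity

/-- The standard left action of `SL(2, ℂ)` on the upper half-space by Möbius transformations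
(Poincaré extension): with `γ = (a b; c d)`,
`γ · (t + u j) = ((a t + b) conj (c t + d) + a conj c u² + u j) / (|c t + d|² + |c|² u²)`. -/
def H3.mobius (γ : SL(2, ℂ)) (z : H3) : H3 where
  t := ((γ 0 0 * z.t + γ 0 1) * (starRingEnd ℂ) (γ 1 0 * z.t + γ 1 1)
      + γ 0 0 * (starRingEnd ℂ) (γ 1 0) * (z.u : ℂ) ^ 2)
      / ((‖γ 1 0 * z.t + γ 1 1‖ ^ 2 + ‖γ 1 0‖ ^ 2 * z.u ^ 2 : ℝ) : ℂ)
  u := z.u / (‖γ 1 0 * z.t + γ 1 1‖ ^ 2 + ‖γ 1 0‖ ^ 2 * z.u ^ 2)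
  pos := div_pos z.pos (H3.denom_pos γ z)

/-! ### Binary forms

The variables are `x = X 0` and `y = X 1`; a binary form of degree `n` is a polynomial
`F : MvPolynomial (Fin 2) ℂ` with `F.IsHomogeneous n`. -/

/-- The size `‖F‖`: the sum of the squared absolute values of the coefficients. -/
def size (F : MvPolynomial (Fin 2) ℂ) : ℝ :=
  ∑ m ∈ F.support, ‖F.coeff m‖ ^ 2

/-- The right action by substitution, `F(x, y) · (a b; c d) = F(a x + b y, c x + d y)`. -/
def act (F : MvPolynomial (Fin 2) ℂ) (γ : SL(2, ℂ)) : MvPolynomial (Fin 2) ℂ :=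
  MvPolynomial.aeval
    ![MvPolynomial.C (γ 0 0) * MvPolynomial.X 0 + MvPolynomial.C (γ 0 1) * MvPolynomial.X 1,
      MvPolynomial.C (γ 1 0) * MvPolynomial.X 0 + MvPolynomial.C (γ 1 1) * MvPolynomial.X 1] F

/-- The linear form `β x - α y` attached to `p = (α, β)`. -/
def linForm (p : ℂ × ℂ) : MvPolynomial (Fin 2) ℂ :=
  MvPolynomial.C p.2 * MvPolynomial.X 0 - MvPolynomial.C p.1 * MvPolynomial.X 1

/-- `F` is a stable form of degree `n`: it is homogeneous of degree `n` and no linear factor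
has multiplicity `≥ n / 2`. -/
def IsStable (n : ℕ) (F : MvPolynomial (Fin 2) ℂ) : Prop :=
  F.IsHomogeneous n ∧ ∀ p : ℂ × ℂ, p ≠ 0 → ∀ m : ℕ, linForm p ^ m ∣ F → 2 * m < n

/-- A choice of `(α₁, β₁), …, (αₙ, βₙ)` with `F = ∏ₖ (βₖ x - αₖ y)`. -/
def factors (n : ℕ) (F : MvPolynomial (Fin 2) ℂ) : Fin n → ℂ × ℂ :=
  Classical.epsilon fun p => F = ∏ k, linForm (p k)

/-- `R(F, t + u j) = ∏ₖ (|αₖ - βₖ t|² + |βₖ|² u²) / u` for `F = ∏ₖ (βₖ x - αₖ y)`. -/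
def R (n : ℕ) (F : MvPolynomial (Fin 2) ℂ) (z : H3) : ℝ :=
  ∏ k, (‖(factors n F k).1 - (factors n F k).2 * z.t‖ ^ 2
    + ‖(factors n F k).2‖ ^ 2 * z.u ^ 2) / z.u

/-- The covariant `z(F)`: the point of the upper half-space at which `R(F, ·)` is minimal. -/
def covariant (n : ℕ) (F : MvPolynomial (Fin 2) ℂ) : H3 :=
  Classical.epsilon fun z => IsMinOn (R n F) Set.univ z

/-- The Julia invariant `θ(F) = R(F, z(F))`. -/
def theta (n : ℕ) (F : MvPolynomial (Fin 2) ℂ) : ℝ := R n F (covariant n F)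

/-- For a form `F₀` with `z(F₀) = j`: the function
`ε_{F₀}(δ) = min {R(F₀, z) / R(F₀, j) : dist(z, j) = δ}`. -/
def epsFun₀ (n : ℕ) (F₀ : MvPolynomial (Fin 2) ℂ) (δ : ℝ) : ℝ :=
  sInf ((fun z => R n F₀ z / R n F₀ H3.j) '' {z | H3.hdist z H3.j = δ})

/-- The point of the unit sphere in `ℂ × ℝ = ℝ³` that corresponds to the point `(α : β)` of the
projective line under stereographic projection; for `β = 1` it is
`(2 α / (|α|² + 1), (|α|² - 1) / (|α|² + 1))`. -/
def spherePoint (p : ℂ × ℂ) : WithLp 2 (ℂ × ℝ) :=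
  WithLp.toLp 2
    (2 * p.1 * (starRingEnd ℂ) p.2 / ((‖p.1‖ ^ 2 + ‖p.2‖ ^ 2 : ℝ) : ℂ),
      (‖p.1‖ ^ 2 - ‖p.2‖ ^ 2) / (‖p.1‖ ^ 2 + ‖p.2‖ ^ 2))

/-- For a form `F₀` with `z(F₀) = j`: the constant
`ε(F₀) = inf (∏ₖ (1 + ⟨φ, φₖ⟩ ρ)) / (1 - ρ²)` over unit vectors `φ` and `0 ≤ ρ < 1`. -/
def epsConst₀ (n : ℕ) (F₀ : MvPolynomial (Fin 2) ℂ) : ℝ :=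
  sInf {x : ℝ | ∃ φ ∈ Metric.sphere (0 : WithLp 2 (ℂ × ℝ)) 1, ∃ ρ ∈ Set.Ico (0 : ℝ) 1,
    x = (∏ k, (1 + inner ℝ φ (spherePoint (factors n F₀ k)) * ρ)) / (1 - ρ ^ 2)}

/-- A choice of a form `F₀` in the `SL(2, ℂ)`-orbit of `F` with `z(F₀) = j`. -/
def normalized (n : ℕ) (F : MvPolynomial (Fin 2) ℂ) : MvPolynomial (Fin 2) ℂ :=
  act F (Classical.epsilon fun γ => covariant n (act F γ) = H3.j)

/-- The function `ε_F = ε_{F₀}`, with `F₀` in the orbit of `F` such that `z(F₀) = j`. -/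
def epsFun (n : ℕ) (F : MvPolynomial (Fin 2) ℂ) : ℝ → ℝ := epsFun₀ n (normalized n F)

/-- The inverse of `ε_F : [0, ∞) → [1, ∞)`. -/
def epsFunInv (n : ℕ) (F : MvPolynomial (Fin 2) ℂ) : ℝ → ℝ :=
  Function.invFunOn (epsFun n F) (Set.Ici 0)

/-- The constant `ε(F) = ε(F₀)`, with `F₀` in the orbit of `F` such that `z(F₀) = j`. -/
def epsConst (n : ℕ) (F : MvPolynomial (Fin 2) ℂ) : ℝ := epsConst₀ n (normalized n F)

/-! ### The definitions do not depend on the chosen factorization -/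

/-- Dehomogenization `F(X, 1)`. -/
def dehom : MvPolynomial (Fin 2) ℂ →ₐ[ℂ] Polynomial ℂ :=
  MvPolynomial.aeval ![Polynomial.X, 1]

theorem dehom_linForm (p : ℂ × ℂ) :
    dehom (linForm p) = Polynomial.C p.2 * Polynomial.X - Polynomial.C p.1 := by
  simp [dehom, linForm, Polynomial.C_eq_algebraMap]

theorem dehom_injOn {n : ℕ} {F : MvPolynomial (Fin 2) ℂ} (hF : F.IsHomogeneous n)
    (h : dehom F = 0) : F = 0 := by
  have hdeg : ∀ m, F.coeff m ≠ 0 → m 0 + m 1 = n := by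
    intro m hm
    have := hF hm
    rw [Finsupp.weight_apply, Finsupp.sum_fintype _ _ (by simp)] at this
    simpa [Fin.sum_univ_two] using this
  by_contra hne
  obtain ⟨m, hm⟩ := MvPolynomial.support_nonempty.mpr hne
  have hm' := MvPolynomial.mem_support_iff.mp hm
  have hc : (dehom F).coeff (m 0) = F.coeff m := by
    rw [dehom, MvPolynomial.aeval_def, MvPolynomial.eval₂_eq', Polynomial.finsetSum_coeff,
      Finset.sum_eq_single m]
    · simp [Polynomial.coeff_X_pow]
    · intro m' hm1 hne'
      have hm2 := MvPolynomial.mem_support_iff.mp hm1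
      have : m 0 ≠ m' 0 := by
        intro h0
        apply hne'
        have h1 := hdeg m hm'
        have h2 := hdeg m' hm2
        ext i
        fin_cases i
        · exact h0.symm
        · show m' 1 = m 1
          omega
      simp [Polynomial.coeff_X_pow, this]
    · intro h1
      exact absurd hm h1
  rw [h] at hc
  exact hm' (by simpa using hc.symm)

theorem linForm_isHomogeneous (p : ℂ × ℂ) : (linForm p).IsHomogeneous 1 := by
  unfold linForm
  exact (MvPolynomial.isHomogeneous_C_mul_X _ _).sub (MvPolynomial.isHomogeneous_C_mul_X _ _)

theorem linForm_smul (c : ℂ) (p : ℂ × ℂ) :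
    linForm (c • p) = MvPolynomial.C c * linForm p := by
  simp [linForm]
  ring

/-- Every binary form of degree `n ≥ 1` is a product of `n` linear forms. -/
theorem exists_factors {n : ℕ} (hn : n ≠ 0) {F : MvPolynomial (Fin 2) ℂ}
    (hF : F.IsHomogeneous n) : ∃ p : Fin n → ℂ × ℂ, F = ∏ k, linForm (p k) := by
  set f := dehom F with hf
  have hd : f.natDegree ≤ n := by
    rw [hf, dehom, MvPolynomial.aeval_def, MvPolynomial.eval₂_eq']
    apply Polynomial.natDegree_sum_le_of_forall_le
    intro m hm
    have := hF (MvPolynomial.mem_support_iff.mp hm)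
    rw [Finsupp.weight_apply, Finsupp.sum_fintype _ _ (by simp)] at this
    simp only [Pi.one_apply, smul_eq_mul, mul_one, Fin.sum_univ_two] at this
    simp only [← Polynomial.C_eq_algebraMap, Fin.prod_univ_two, Matrix.cons_val_zero,
      Matrix.cons_val_one, one_pow, mul_one]
    exact (Polynomial.natDegree_C_mul_X_pow_le _ _).trans (by omega)
  have hs := IsAlgClosed.splits f
  have hcard : f.roots.card = f.natDegree := hs.natDegree_eq_card_roots.symm
  set M : Multiset (ℂ × ℂ) :=
    f.roots.map (fun r => (r, (1 : ℂ))) + Multiset.replicate (n - f.natDegree) (-1, 0) with hM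
  have hMc : M.card = n := by
    simp [hM, hcard]
    omega
  obtain ⟨l, hl⟩ := Quotient.exists_rep M
  have hl' : (l : Multiset (ℂ × ℂ)) = M := hl
  have hlen : l.length = n := by rw [← hMc, ← hl', Multiset.coe_card]
  subst hlen
  have hprod : (∏ k, linForm (l.get k)) = (M.map linForm).prod := by
    rw [← hl', Multiset.map_coe, Multiset.prod_coe, ← List.prod_ofFn]
    congr 1
    conv_rhs => rw [← List.ofFn_get l, List.map_ofFn]
    rfl
  have key : F = MvPolynomial.C f.leadingCoeff * ∏ k, linForm (l.get k) := by
    rw [← sub_eq_zero]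
    apply dehom_injOn (n := l.length)
    · refine hF.sub ?_
      have h1 := MvPolynomial.IsHomogeneous.prod (Finset.univ : Finset (Fin l.length))
        (fun k => linForm (l.get k)) (fun _ => 1) (fun k _ => linForm_isHomogeneous _)
      have h2 := (MvPolynomial.isHomogeneous_C (Fin 2) f.leadingCoeff).mul h1
      simpa using h2
    · rw [map_sub, map_mul, hprod, map_multiset_prod, Multiset.map_map, ← hf, sub_eq_zero]
      have : dehom ∘ linForm = fun p : ℂ × ℂ =>
          Polynomial.C p.2 * Polynomial.X - Polynomial.C p.1 := by
        ext1 p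
        exact dehom_linForm p
      rw [this, hM, Multiset.map_add, Multiset.prod_add, Multiset.map_map,
        Multiset.map_replicate, Multiset.prod_replicate]
      conv_lhs => rw [hs.eq_prod_roots]
      have hC : dehom (MvPolynomial.C f.leadingCoeff) = Polynomial.C f.leadingCoeff := by
        simp [dehom, Polynomial.C_eq_algebraMap]
      simp only [hC, Function.comp_def, map_one, one_mul, map_zero, zero_mul, zero_sub,
        map_neg, neg_neg, one_pow, mul_one]
  have h0 : 0 < l.length := Nat.pos_of_ne_zero hn
  refine ⟨fun k => (if k = ⟨0, h0⟩ then f.leadingCoeff else 1) • l.get k, ?_⟩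
  rw [key]
  simp only [linForm_smul, Finset.prod_mul_distrib]
  congr 1
  rw [← map_prod]
  simp

/-- A function of `(α, β)` that is homogeneous of degree two in absolute value has a product
over the linear factors that does not depend on the factorization. -/
theorem prod_eq_of_factors {n : ℕ} (Q : ℂ × ℂ → ℝ)
    (hQ : ∀ (c : ℂ) (p : ℂ × ℂ), Q (c • p) = ‖c‖ ^ 2 * Q p) (p q : Fin n → ℂ × ℂ)
    (h : ∏ k, linForm (p k) = ∏ k, linForm (q k)) : ∏ k, Q (p k) = ∏ k, Q (q k) := by
  have hQ0 : Q 0 = 0 := by simpa using hQ 0 0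
  have hlin0 : ∀ r : ℂ × ℂ, linForm r = 0 → r = 0 := by
    intro r hr
    have := congrArg dehom hr
    rw [dehom_linForm, map_zero] at this
    have h0 := congrArg (fun g => Polynomial.coeff g 0) this
    have h1 := congrArg (fun g => Polynomial.coeff g 1) this
    simp [Polynomial.coeff_C] at h0 h1
    ext <;> simp [h0, h1]
  have main : ∀ p : Fin n → ℂ × ℂ, (∀ k, p k ≠ 0) → ∀ s : Finset (Fin n),
      (dehom (∏ k ∈ s, linForm (p k))) ≠ 0 ∧
      (dehom (∏ k ∈ s, linForm (p k))).natDegree ≤ s.card ∧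
      ∏ k ∈ s, Q (p k) = ‖(dehom (∏ k ∈ s, linForm (p k))).leadingCoeff‖ ^ 2 *
        ((dehom (∏ k ∈ s, linForm (p k))).roots.map (fun r => Q (r, 1))).prod *
        Q (1, 0) ^ (s.card - (dehom (∏ k ∈ s, linForm (p k))).natDegree) := by
    intro p hp s
    induction s using Finset.induction_on with
    | empty => simp
    | insert a s ha ih =>
      obtain ⟨ih0, ihd, ih⟩ := ih
      rw [Finset.prod_insert ha, Finset.prod_insert ha, map_mul, Finset.card_insert_of_notMem ha]
      set g := dehom (∏ k ∈ s, linForm (p k))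
      have hl : dehom (linForm (p a)) ≠ 0 ∧ (dehom (linForm (p a))).natDegree ≤ 1 ∧
          Q (p a) = ‖(dehom (linForm (p a))).leadingCoeff‖ ^ 2 *
            ((dehom (linForm (p a))).roots.map (fun r => Q (r, 1))).prod *
            Q (1, 0) ^ (1 - (dehom (linForm (p a))).natDegree) := by
        rw [dehom_linForm]
        have hpa := hp a
        generalize p a = w at hpa
        obtain ⟨α, β⟩ := w
        by_cases hβ : β = 0
        · subst hβ
          have hα : α ≠ 0 := by
            intro h
            exact hpa (by simp [h])
          have := hQ α (1, 0)
          simp at this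
          simp [this, hα]
        · have he : Polynomial.C β * Polynomial.X - Polynomial.C α
              = Polynomial.C β * (Polynomial.X - Polynomial.C (α / β)) := by
            rw [mul_sub, ← Polynomial.C_mul, mul_div_cancel₀ _ hβ]
          have h2 := hQ β (α / β, 1)
          simp [mul_div_cancel₀ _ hβ] at h2
          simp only [he]
          refine ⟨?_, ?_, ?_⟩
          · exact mul_ne_zero (by simpa using hβ) (Polynomial.X_sub_C_ne_zero _)
          · rw [Polynomial.natDegree_C_mul hβ, Polynomial.natDegree_X_sub_C]
          · rw [Polynomial.natDegree_C_mul hβ, Polynomial.natDegree_X_sub_C,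
              Polynomial.roots_C_mul _ hβ, Polynomial.roots_X_sub_C]
            simp [h2]
      obtain ⟨hl0, hld, hl⟩ := hl
      refine ⟨mul_ne_zero hl0 ih0, ?_, ?_⟩
      · rw [Polynomial.natDegree_mul hl0 ih0]
        omega
      · rw [ih, hl, Polynomial.natDegree_mul hl0 ih0, Polynomial.leadingCoeff_mul,
          Polynomial.roots_mul (mul_ne_zero hl0 ih0), Multiset.map_add, Multiset.prod_add,
          norm_mul]
        have : s.card + 1 - ((dehom (linForm (p a))).natDegree + g.natDegree)
            = (1 - (dehom (linForm (p a))).natDegree) + (s.card - g.natDegree) := by omega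
        rw [this, pow_add]
        ring
  by_cases hz : ∏ k, linForm (p k) = 0
  · have e : ∀ p : Fin n → ℂ × ℂ, ∏ k, linForm (p k) = 0 → ∏ k, Q (p k) = 0 := by
      intro p hp
      obtain ⟨k, hk, h0⟩ := Finset.prod_eq_zero_iff.mp hp
      exact Finset.prod_eq_zero hk (by rw [hlin0 _ h0, hQ0])
    rw [e p hz, e q (h ▸ hz)]
  · have e : ∀ p : Fin n → ℂ × ℂ, ∏ k, linForm (p k) ≠ 0 → ∀ k, p k ≠ 0 := by
      intro p hp k hk
      exact hp (Finset.prod_eq_zero (Finset.mem_univ k) (by simp [hk, linForm]))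
    rw [(main p (e p hz) Finset.univ).2.2, (main q (e q (h ▸ hz)) Finset.univ).2.2, h]

theorem factors_spec {n : ℕ} {F : MvPolynomial (Fin 2) ℂ}
    (h : ∃ p : Fin n → ℂ × ℂ, F = ∏ k, linForm (p k)) : F = ∏ k, linForm (factors n F k) :=
  Classical.epsilon_spec h

/-- `R` may be computed from any factorization. -/
theorem R_eq {n : ℕ} (p : Fin n → ℂ × ℂ) (z : H3) :
    R n (∏ k, linForm (p k)) z
      = ∏ k, (‖(p k).1 - (p k).2 * z.t‖ ^ 2 + ‖(p k).2‖ ^ 2 * z.u ^ 2) / z.u := by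
  refine prod_eq_of_factors
    (fun r => (‖r.1 - r.2 * z.t‖ ^ 2 + ‖r.2‖ ^ 2 * z.u ^ 2) / z.u) ?_ _ _
    (factors_spec ⟨p, rfl⟩).symm
  intro c r
  have : c * r.1 - c * r.2 * z.t = c * (r.1 - r.2 * z.t) := by ring
  simp only [Prod.smul_fst, Prod.smul_snd, smul_eq_mul, this, norm_mul]
  ring

/-- The product in the definition of `ε(F₀)` may be computed from any factorization. -/
theorem prod_sphere_eq {n : ℕ} (p : Fin n → ℂ × ℂ) (hp : ∀ k, p k ≠ 0)
    (φ : WithLp 2 (ℂ × ℝ)) (ρ : ℝ) :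
    ∏ k, (1 + inner ℝ φ (spherePoint (factors n (∏ k, linForm (p k)) k)) * ρ)
      = ∏ k, (1 + inner ℝ φ (spherePoint (p k)) * ρ) := by
  set q := factors n (∏ k, linForm (p k)) with hq
  have hpq : ∏ k, linForm (q k) = ∏ k, linForm (p k) := (factors_spec ⟨p, rfl⟩).symm
  let N : ℂ × ℂ → ℝ := fun r => ‖r.1‖ ^ 2 + ‖r.2‖ ^ 2
  have hN : ∀ (c : ℂ) (r : ℂ × ℂ), N (c • r) = ‖c‖ ^ 2 * N r := by
    intro c r
    simp [N]
    ring
  have hsph : ∀ (c : ℂ) (r : ℂ × ℂ), c ≠ 0 → spherePoint (c • r) = spherePoint r := by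
    intro c r hc
    have hc' : ‖c‖ ^ 2 ≠ 0 := by simpa using hc
    unfold spherePoint
    congr 2
    · have h1 : ‖(c • r).1‖ ^ 2 + ‖(c • r).2‖ ^ 2 = ‖c‖ ^ 2 * (‖r.1‖ ^ 2 + ‖r.2‖ ^ 2) := hN c r
      have h2 : 2 * (c • r).1 * (starRingEnd ℂ) (c • r).2
          = ((‖c‖ ^ 2 : ℝ) : ℂ) * (2 * r.1 * (starRingEnd ℂ) r.2) := by
        have := Complex.mul_conj' c
        simp only [Prod.smul_fst, Prod.smul_snd, smul_eq_mul, map_mul]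
        push_cast
        rw [← this]
        ring
      rw [h1, h2, Complex.ofReal_mul, mul_div_mul_left _ _ (by exact_mod_cast hc')]
    · have h1 : ‖(c • r).1‖ ^ 2 + ‖(c • r).2‖ ^ 2 = ‖c‖ ^ 2 * (‖r.1‖ ^ 2 + ‖r.2‖ ^ 2) := hN c r
      have h2 : ‖(c • r).1‖ ^ 2 - ‖(c • r).2‖ ^ 2 = ‖c‖ ^ 2 * (‖r.1‖ ^ 2 - ‖r.2‖ ^ 2) := by
        simp
        ring
      rw [h1, h2, mul_div_mul_left _ _ hc']
  have h1 := prod_eq_of_factors N hN q p hpq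
  have h2 := prod_eq_of_factors
    (fun r => N r * (1 + inner ℝ φ (spherePoint r) * ρ)) (by
      intro c r
      by_cases hc : c = 0
      · simp [hc, N]
      · simp only [hN, hsph c r hc]
        ring) q p hpq
  rw [Finset.prod_mul_distrib, Finset.prod_mul_distrib, h1] at h2
  refine mul_left_cancel₀ (Finset.prod_ne_zero_iff.mpr fun k _ => ?_) h2
  intro h0
  apply hp k
  have ha := sq_nonneg ‖(p k).1‖
  have hb := sq_nonneg ‖(p k).2‖
  simp only [N] at h0
  have h3 : ‖(p k).1‖ ^ 2 = 0 := by linarith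
  have h4 : ‖(p k).2‖ ^ 2 = 0 := by linarith
  rw [sq_eq_zero_iff, norm_eq_zero] at h3 h4
  exact Prod.ext h3 h4

end

end BinaryForm

open BinaryForm

namespace BinaryForm

noncomputable section

open scoped ComplexConjugate

/-! A linear factor `βx - αy` defines a function on the half-space, `hermForm`, and `R(F, ·)` is the
product of these. Moving the point by `γ` has the same effect as applying `γ⁻¹` to the vector `(α,
β)` (`hermForm_mobius`), so `R(F·γ, z) = R(F, γz)`. The distance is invariant and the action
transitive, so questions about the minimizer reduce to the base point `j`.

In polar coordinates about `j` (direction `ω`, distance `s`) the ratio `R(F, z) / R(F, j)` is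
`growth`, the product of the `cosh s - ⟨ω, φₖ⟩ sinh s`. Factors with `φₖ ≠ ω` grow like `e^s` and
the others equal `e^(-s)`. Stability says that fewer than half of the `φₖ` coincide with `ω`; by
compactness of the sphere, `growth` is at least `c e^s` uniformly in `ω` (`exists_growth_ge`), so a
minimizer exists. If `j` is a minimizer, vanishing first derivatives give `∑ φₖ = 0`. With this,
`growth` strictly increases along each ray (`strictMonoOn_growth`), which yields uniqueness and the
monotonicity of `ε_F`, and AM-GM gives `growth ≤ cosh^n`.

The size is compared with `R(F, j) = ∏ (|αₖ|² + |βₖ|²)` through Parseval's identity on the unit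
circle (`prod_pairNorm_le_size`, `size_le_prod_pairNorm`). Since `R(F, j) / θ(F)` lies between
`ε_F(δ)` and `(cosh δ)^n`, the two-sided bound follows. The lower bound applied to `F·γ`, whose
value at `j` is `R(F, γj)`, shows that the size is large when `γj` is far from `z(F)`, equivalently
when `γ⁻¹z(F)` is far from `j`. For squarefree `F`, the substitution `ρ = tanh s` identifies `ε(F)`
as the best constant in `R / θ ≥ ε(F) cosh^(n-2)`, which makes the condition explicit. -/

/-! ### Equivariance of the Hermitian forms and of the distance. -/

/-- The Hermitian form `(|α - β t|² + |β|² u²) / u` attached to a point of the half-space. -/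
def hermForm (p : ℂ × ℂ) (z : H3) : ℝ := (‖p.1 - p.2 * z.t‖ ^ 2 + ‖p.2‖ ^ 2 * z.u ^ 2) / z.u

/-- The determinant of two vectors of `ℂ²`. -/
def pairDet (p q : ℂ × ℂ) : ℂ := p.1 * q.2 - p.2 * q.1

/-- The action of `γ⁻¹` on column vectors of length two. -/
def pullPair (γ : SL(2, ℂ)) (p : ℂ × ℂ) : ℂ × ℂ :=
  (γ 1 1 * p.1 - γ 0 1 * p.2, γ 0 0 * p.2 - γ 1 0 * p.1)

/-- `|α|² + |β|²`. -/
def pairNorm (p : ℂ × ℂ) : ℝ := ‖p.1‖ ^ 2 + ‖p.2‖ ^ 2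

theorem det_eq (γ : SL(2, ℂ)) : γ 0 0 * γ 1 1 - γ 0 1 * γ 1 0 = 1 := by
  have := Matrix.SpecialLinearGroup.det_coe γ
  rwa [Matrix.det_fin_two] at this

theorem inv_apply (γ : SL(2, ℂ)) :
    γ⁻¹ 0 0 = γ 1 1 ∧ γ⁻¹ 0 1 = -γ 0 1 ∧ γ⁻¹ 1 0 = -γ 1 0 ∧ γ⁻¹ 1 1 = γ 0 0 := by
  simp [Matrix.SpecialLinearGroup.SL2_inv_expl γ]

theorem pullPair_inv_pullPair (γ : SL(2, ℂ)) (p : ℂ × ℂ) :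
    pullPair γ⁻¹ (pullPair γ p) = p := by
  obtain ⟨h1, h2, h3, h4⟩ := inv_apply γ
  have h := det_eq γ
  simp only [pullPair, h1, h2, h3, h4]
  ext
  · linear_combination p.1 * h
  · linear_combination p.2 * h

theorem pullPair_pullPair_inv (γ : SL(2, ℂ)) (p : ℂ × ℂ) :
    pullPair γ (pullPair γ⁻¹ p) = p := by
  simpa using pullPair_inv_pullPair γ⁻¹ p

theorem pairDet_pullPair (γ : SL(2, ℂ)) (p q : ℂ × ℂ) :
    pairDet (pullPair γ p) (pullPair γ q) = pairDet p q := by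
  have h := det_eq γ
  simp only [pullPair, pairDet]
  linear_combination (p.1 * q.2 - p.2 * q.1) * h

theorem pullPair_ne_zero (γ : SL(2, ℂ)) {p : ℂ × ℂ} (hp : p ≠ 0) : pullPair γ p ≠ 0 := by
  intro h
  apply hp
  rw [← pullPair_inv_pullPair γ p, h]
  simp [pullPair]

theorem hermForm_mobius (γ : SL(2, ℂ)) (p : ℂ × ℂ) (z : H3) :
    hermForm p (H3.mobius γ z) = hermForm (pullPair γ p) z := by
  obtain ⟨t, u, hu⟩ := z
  obtain ⟨α, β⟩ := p
  have hD := H3.denom_pos γ ⟨t, u, hu⟩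
  have hdet := det_eq γ
  simp only [hermForm, pullPair, H3.mobius] at hD ⊢
  generalize γ 0 0 = a at *
  generalize γ 0 1 = b at *
  generalize γ 1 0 = c at *
  generalize γ 1 1 = d at *
  set D : ℝ := ‖c * t + d‖ ^ 2 + ‖c‖ ^ 2 * u ^ 2 with hDdef
  set T : ℂ := (a * t + b) * conj (c * t + d) + a * conj c * (u : ℂ) ^ 2 with hT
  have hD' : (D : ℂ) ≠ 0 := by exact_mod_cast hD.ne'
  have e1 : α - β * (T / D) = (D * α - β * T) / D := by field_simp
  -- Written with `w * conj w` for squared norms, the two sides differ by a multiple of `det γ *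
  -- conj (det γ) - 1`.
  have key : ‖D * α - β * T‖ ^ 2 + ‖β‖ ^ 2 * u ^ 2
      = D * (‖d * α - b * β - (a * β - c * α) * t‖ ^ 2 + ‖a * β - c * α‖ ^ 2 * u ^ 2) := by
    have hdet' : (a * d - b * c) * (conj a * conj d - conj b * conj c) = 1 := by
      have := congrArg conj hdet
      simp only [map_sub, map_mul, map_one] at this
      rw [hdet, this, one_mul]
    have hDc : (D : ℂ) = (c * t + d) * (conj c * conj t + conj d) + c * conj c * u ^ 2 := by
      rw [hDdef]
      push_cast
      simp only [← Complex.mul_conj', map_add, map_mul]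
    apply Complex.ofReal_injective
    push_cast
    simp only [← Complex.mul_conj', map_sub, map_add, map_mul, hT, map_pow, Complex.conj_conj,
      Complex.conj_ofReal, hDc]
    linear_combination (-β * conj β * (u : ℂ) ^ 2) * hdet'
  rw [e1, norm_div, Complex.norm_real, Real.norm_of_nonneg hD.le]
  have e2 : ((‖D * α - β * T‖ / D) ^ 2 + ‖β‖ ^ 2 * (u / D) ^ 2) / (u / D)
      = (‖D * α - β * T‖ ^ 2 + ‖β‖ ^ 2 * u ^ 2) / (D * u) := by
    field_simp
  rw [e2, key, mul_div_mul_left _ _ hD.ne']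

/-- The vector `(1, 0)` gives `1 / u`, and the other three then determine `t`. Identities between
points, such as `γ⁻¹γz = z`, can thus be checked on vectors of `ℂ²` rather than on the Möbius
formula. -/
theorem hermForm_ext {z w : H3} (h : ∀ p, hermForm p z = hermForm p w) : z = w := by
  obtain ⟨t, u, hu⟩ := z
  obtain ⟨s, v, hv⟩ := w
  have h1 := h (1, 0)
  have h2 := h (0, 1)
  have h3 := h (1, 1)
  have h4 := h (Complex.I, 1)
  simp [hermForm] at h1
  subst h1
  simp only [hermForm, ← Complex.normSq_eq_norm_sq, Complex.normSq_apply] at h2 h3 h4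
  have hu' := hu.ne'
  field_simp at h2 h3 h4
  simp at h2 h3 h4
  ext
  · apply Complex.ext <;> simp <;> linarith
  · rfl

theorem mobius_inv_mobius (γ : SL(2, ℂ)) (z : H3) : H3.mobius γ⁻¹ (H3.mobius γ z) = z :=
  hermForm_ext fun p => by
    rw [hermForm_mobius, hermForm_mobius, pullPair_pullPair_inv]

theorem mobius_mobius_inv (γ : SL(2, ℂ)) (z : H3) : H3.mobius γ (H3.mobius γ⁻¹ z) = z := by
  simpa using mobius_inv_mobius γ⁻¹ z

/-- `cosh` of the distance of two points. -/
def coshDist (z w : H3) : ℝ := 1 + (‖z.t - w.t‖ ^ 2 + (z.u - w.u) ^ 2) / (2 * z.u * w.u)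

theorem one_le_coshDist (z w : H3) : 1 ≤ coshDist z w := by
  have := z.pos
  have := w.pos
  unfold coshDist
  have : 0 ≤ (‖z.t - w.t‖ ^ 2 + (z.u - w.u) ^ 2) / (2 * z.u * w.u) := by positivity
  linarith

theorem cosh_hdist (z w : H3) : Real.cosh (z.hdist w) = coshDist z w :=
  Real.cosh_arcosh (one_le_coshDist z w)

theorem hdist_nonneg (z w : H3) : 0 ≤ z.hdist w := Real.arcosh_nonneg (one_le_coshDist z w)

theorem hdist_eq_iff {z w z' w' : H3} (h : coshDist z w = coshDist z' w') :
    z.hdist w = z'.hdist w' := congrArg Real.arcosh h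

theorem coshDist_comm (z w : H3) : coshDist z w = coshDist w z := by
  unfold coshDist
  rw [norm_sub_rev]
  ring

theorem coshDist_j (z : H3) : coshDist z H3.j = (‖z.t‖ ^ 2 + z.u ^ 2 + 1) / (2 * z.u) := by
  have := z.pos.ne'
  simp only [coshDist, H3.j, sub_zero]
  field_simp
  ring

/-- The point `z` enters only through `hermForm`, so `hermForm_mobius` settles its part of the
invariance and only the image of `w` has to be expanded. -/
theorem coshDist_eq_hermForm (z w : H3) :
    2 * coshDist z w = (hermForm (w.t, 1) z + w.u ^ 2 * hermForm (1, 0) z) / w.u := by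
  have h1 := z.pos.ne'
  have h2 := w.pos.ne'
  simp only [coshDist, hermForm]
  simp
  rw [norm_sub_rev]
  field_simp
  ring

/-- The distance is invariant under Möbius transformations. -/
theorem coshDist_mobius (γ : SL(2, ℂ)) (z w : H3) :
    coshDist (H3.mobius γ z) (H3.mobius γ w) = coshDist z w := by
  suffices h : 2 * coshDist (H3.mobius γ z) (H3.mobius γ w) = 2 * coshDist z w by linarith
  rw [coshDist_eq_hermForm, coshDist_eq_hermForm, hermForm_mobius, hermForm_mobius]
  obtain ⟨t, u, hu⟩ := z
  obtain ⟨s, v, hv⟩ := w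
  have hD := H3.denom_pos γ ⟨s, v, hv⟩
  have hdet := det_eq γ
  simp only [hermForm, pullPair, H3.mobius] at hD ⊢
  generalize γ 0 0 = a at *
  generalize γ 0 1 = b at *
  generalize γ 1 0 = c at *
  generalize γ 1 1 = d at *
  set D : ℝ := ‖c * s + d‖ ^ 2 + ‖c‖ ^ 2 * v ^ 2 with hDdef
  set T : ℂ := (a * s + b) * conj (c * s + d) + a * conj c * (v : ℂ) ^ 2 with hT
  have hD' : (D : ℂ) ≠ 0 := by exact_mod_cast hD.ne'
  have hdet' : (conj a * conj d - conj b * conj c) = 1 := by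
    have := congrArg conj hdet
    simpa only [map_sub, map_mul, map_one] using this
  have hDc : (D : ℂ) = (c * s + d) * (conj c * conj s + conj d) + c * conj c * v ^ 2 := by
    rw [hDdef]
    push_cast
    simp only [← Complex.mul_conj', map_add, map_mul]
  have hv' : (v : ℂ) ≠ 0 := by exact_mod_cast hv.ne'
  have hu' : (u : ℂ) ≠ 0 := by exact_mod_cast hu.ne'
  have f1 : d * T - b * D = s * (conj c * conj s + conj d) + conj c * v ^ 2 := by
    rw [hT, hDc, map_add, map_mul]
    linear_combination (s * (conj c * conj s + conj d) + conj c * v ^ 2) * hdet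
  have f2 : a * D - c * T = conj c * conj s + conj d := by
    rw [hT, hDc, map_add, map_mul]
    linear_combination (conj c * conj s + conj d) * hdet
  have f3 : d * (T / D) - b * 1 = (s * (conj c * conj s + conj d) + conj c * v ^ 2) / D := by
    rw [← f1]; field_simp
  have f4 : a * 1 - c * (T / D) = (conj c * conj s + conj d) / D := by
    rw [← f2]; field_simp
  rw [f3, f4]
  apply Complex.ofReal_injective
  push_cast
  simp only [← Complex.mul_conj', map_sub, map_add, map_mul, map_div₀, map_pow, Complex.conj_conj,
      Complex.conj_ofReal, map_one, map_zero]
  field_simp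
  rw [hDc]
  ring

theorem exists_mobius_j (z : H3) : ∃ γ : SL(2, ℂ), H3.mobius γ H3.j = z := by
  have hu := z.pos
  have hs : 0 < Real.sqrt z.u := Real.sqrt_pos.mpr hu
  have hs' : ((Real.sqrt z.u : ℝ) : ℂ) ≠ 0 := by exact_mod_cast hs.ne'
  refine ⟨⟨!![(Real.sqrt z.u : ℂ), z.t / Real.sqrt z.u; 0, 1 / Real.sqrt z.u], ?_⟩, ?_⟩
  · rw [Matrix.det_fin_two_of]
    field_simp
    simp
  · have h2 : Real.sqrt z.u ^ 2 = z.u := Real.sq_sqrt hu.le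
    ext
    · simp [H3.mobius, H3.j, abs_of_pos hs]
      field_simp
    · simp [H3.mobius, H3.j, abs_of_pos hs, h2]

theorem act_prod_linForm {n : ℕ} (p : Fin n → ℂ × ℂ) (γ : SL(2, ℂ)) :
    act (∏ k, linForm (p k)) γ = ∏ k, linForm (pullPair γ (p k)) := by
  unfold act
  rw [map_prod]
  refine Finset.prod_congr rfl fun k _ => ?_
  simp only [linForm, pullPair, map_sub, map_mul, MvPolynomial.aeval_X, MvPolynomial.aeval_C,
    MvPolynomial.algebraMap_eq, Matrix.cons_val_zero, Matrix.cons_val_one]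
  ring

theorem R_prod {n : ℕ} (p : Fin n → ℂ × ℂ) (z : H3) :
    R n (∏ k, linForm (p k)) z = ∏ k, hermForm (p k) z := R_eq p z

theorem R_act {n : ℕ} (p : Fin n → ℂ × ℂ) (γ : SL(2, ℂ)) (z : H3) :
    R n (act (∏ k, linForm (p k)) γ) z = R n (∏ k, linForm (p k)) (H3.mobius γ z) := by
  rw [act_prod_linForm, R_prod, R_prod]
  exact Finset.prod_congr rfl fun k _ => (hermForm_mobius γ (p k) z).symm

theorem pairNorm_pos {p : ℂ × ℂ} (hp : p ≠ 0) : 0 < pairNorm p := by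
  unfold pairNorm
  by_contra h
  apply hp
  have ha := sq_nonneg ‖p.1‖
  have hb := sq_nonneg ‖p.2‖
  have h3 : ‖p.1‖ ^ 2 = 0 := by linarith
  have h4 : ‖p.2‖ ^ 2 = 0 := by linarith
  rw [sq_eq_zero_iff, norm_eq_zero] at h3 h4
  exact Prod.ext h3 h4

theorem hermForm_j (p : ℂ × ℂ) : hermForm p H3.j = pairNorm p := by
  simp [hermForm, H3.j, pairNorm]

theorem hermForm_pos {p : ℂ × ℂ} (hp : p ≠ 0) (z : H3) : 0 < hermForm p z := by
  obtain ⟨γ, rfl⟩ := exists_mobius_j z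
  rw [hermForm_mobius, hermForm_j]
  exact pairNorm_pos (pullPair_ne_zero γ hp)

/-! ### Polar coordinates -/

theorem inner_eq (x y : WithLp 2 (ℂ × ℝ)) :
    inner ℝ x y = x.fst.re * y.fst.re + x.fst.im * y.fst.im + x.snd * y.snd := by
  rw [WithLp.prod_inner_apply, Complex.inner]
  simp
  ring

theorem norm_sq_eq (x : WithLp 2 (ℂ × ℝ)) :
    ‖x‖ ^ 2 = x.fst.re ^ 2 + x.fst.im ^ 2 + x.snd ^ 2 := by
  rw [← real_inner_self_eq_norm_sq, inner_eq]
  ring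

theorem unit_eq {x : WithLp 2 (ℂ × ℝ)} (hx : ‖x‖ = 1) :
    x.fst.re ^ 2 + x.fst.im ^ 2 + x.snd ^ 2 = 1 := by
  rw [← norm_sq_eq, hx, one_pow]

theorem abs_inner_le_one {x y : WithLp 2 (ℂ × ℝ)} (hx : ‖x‖ = 1) (hy : ‖y‖ = 1) :
    |inner ℝ x y| ≤ 1 := by
  simpa [hx, hy] using abs_real_inner_le_norm x y

theorem cosh_sub_mul_sinh_pos {a : ℝ} (ha : |a| ≤ 1) (s : ℝ) :
    0 < Real.cosh s - a * Real.sinh s := by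
  have h1 : |a * Real.sinh s| ≤ |Real.sinh s| := by
    rw [abs_mul]
    exact mul_le_of_le_one_left (abs_nonneg _) ha
  have h2 : |Real.sinh s| < Real.cosh s := by
    rw [abs_lt]
    constructor
    · have := Real.exp_pos s
      rw [← Real.cosh_add_sinh] at this
      linarith
    · exact Real.sinh_lt_cosh s
  linarith [le_abs_self (a * Real.sinh s)]

theorem abs_snd_le_one {ω : WithLp 2 (ℂ × ℝ)} (hω : ‖ω‖ = 1) : |ω.snd| ≤ 1 := by
  rw [abs_le_one_iff_mul_self_le_one]
  have := unit_eq hω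
  nlinarith [sq_nonneg ω.fst.re, sq_nonneg ω.fst.im]

/-- The point at distance `s` from `j` in the direction `ω`. -/
def polar (ω : WithLp 2 (ℂ × ℝ)) (hω : ‖ω‖ = 1) (s : ℝ) : H3 where
  t := ((Real.sinh s / (Real.cosh s - ω.snd * Real.sinh s) : ℝ) : ℂ) * ω.fst
  u := 1 / (Real.cosh s - ω.snd * Real.sinh s)
  pos := one_div_pos.mpr (cosh_sub_mul_sinh_pos (abs_snd_le_one hω) s)

theorem pairNorm_eq (p : ℂ × ℂ) :
    pairNorm p = p.1.re ^ 2 + p.1.im ^ 2 + (p.2.re ^ 2 + p.2.im ^ 2) := by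
  simp only [pairNorm, ← Complex.normSq_eq_norm_sq, Complex.normSq_apply]
  ring

theorem spherePoint_fst (p : ℂ × ℂ) :
    (spherePoint p).fst = 2 * p.1 * conj p.2 / ((pairNorm p : ℝ) : ℂ) := rfl

theorem spherePoint_re (p : ℂ × ℂ) :
    (spherePoint p).fst.re = 2 * (p.1.re * p.2.re + p.1.im * p.2.im) / pairNorm p := by
  rw [spherePoint_fst, Complex.div_ofReal_re]
  simp
  ring

theorem spherePoint_im (p : ℂ × ℂ) :
    (spherePoint p).fst.im = 2 * (p.1.im * p.2.re - p.1.re * p.2.im) / pairNorm p := by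
  rw [spherePoint_fst, Complex.div_ofReal_im]
  simp
  ring

theorem spherePoint_snd (p : ℂ × ℂ) : (spherePoint p).snd
    = (p.1.re ^ 2 + p.1.im ^ 2 - (p.2.re ^ 2 + p.2.im ^ 2)) / pairNorm p := by
  have : (spherePoint p).snd = (‖p.1‖ ^ 2 - ‖p.2‖ ^ 2) / pairNorm p := rfl
  rw [this]
  simp only [← Complex.normSq_eq_norm_sq, Complex.normSq_apply]
  ring

/-- This is a Lorentzian pairing: `p` corresponds to the null vector `pairNorm p * (1, φ)`, and the
point of the ray to `(cosh s, sinh s * ω)` on the hyperboloid. -/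
theorem hermForm_polar {p : ℂ × ℂ} (hp : p ≠ 0) {ω : WithLp 2 (ℂ × ℝ)} (hω : ‖ω‖ = 1) (s : ℝ) :
    hermForm p (polar ω hω s)
      = pairNorm p * (Real.cosh s - inner ℝ ω (spherePoint p) * Real.sinh s) := by
  have hN := (pairNorm_pos hp).ne'
  have hd := (cosh_sub_mul_sinh_pos (abs_snd_le_one hω) s).ne'
  have hu := unit_eq hω
  have hcs := Real.cosh_sq s
  rw [inner_eq, spherePoint_re, spherePoint_im, spherePoint_snd]
  have hR : pairNorm p * (Real.cosh s - (ω.fst.re * (2 * (p.1.re * p.2.re + p.1.im * p.2.im)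
      / pairNorm p) + ω.fst.im * (2 * (p.1.im * p.2.re - p.1.re * p.2.im) / pairNorm p)
      + ω.snd * ((p.1.re ^ 2 + p.1.im ^ 2 - (p.2.re ^ 2 + p.2.im ^ 2)) / pairNorm p))
      * Real.sinh s)
      = pairNorm p * Real.cosh s - (ω.fst.re * (2 * (p.1.re * p.2.re + p.1.im * p.2.im))
      + ω.fst.im * (2 * (p.1.im * p.2.re - p.1.re * p.2.im))
      + ω.snd * (p.1.re ^ 2 + p.1.im ^ 2 - (p.2.re ^ 2 + p.2.im ^ 2))) * Real.sinh s := by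
    field_simp
  rw [hR, pairNorm_eq]
  simp only [hermForm, polar]
  have hE : Real.sinh s ^ 2 * (ω.fst.re ^ 2 + ω.fst.im ^ 2) + 1
      = (Real.cosh s - ω.snd * Real.sinh s) * (Real.cosh s + ω.snd * Real.sinh s) := by
    linear_combination Real.sinh s ^ 2 * hu - hcs
  simp only [← Complex.normSq_eq_norm_sq, Complex.normSq_apply, Complex.sub_re, Complex.sub_im,
    Complex.mul_re, Complex.mul_im, Complex.ofReal_re, Complex.ofReal_im]
  generalize hc : Real.cosh s = c at *
  generalize Real.sinh s = r at *
  -- Trading `cosh s` for the denominator `D` of `polar` leaves `hE` as the only relation needed.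
  have hc' : c = (c - ω.snd * r) + ω.snd * r := by ring
  generalize c - ω.snd * r = D at *
  rw [hc'] at hE ⊢
  field_simp
  linear_combination (p.2.re ^ 2 + p.2.im ^ 2) * hE

theorem coshDist_polar {ω : WithLp 2 (ℂ × ℝ)} (hω : ‖ω‖ = 1) (s : ℝ) :
    coshDist (polar ω hω s) H3.j = Real.cosh s := by
  have hd := (cosh_sub_mul_sinh_pos (abs_snd_le_one hω) s).ne'
  have hu := unit_eq hω
  have hcs := Real.cosh_sq s
  rw [coshDist_j]
  have hE : Real.sinh s ^ 2 * (ω.fst.re ^ 2 + ω.fst.im ^ 2) + 1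
      = (Real.cosh s - ω.snd * Real.sinh s) * (Real.cosh s + ω.snd * Real.sinh s) := by
    linear_combination Real.sinh s ^ 2 * hu - hcs
  simp only [polar, ← Complex.normSq_eq_norm_sq, Complex.normSq_apply, Complex.re_ofReal_mul,
    Complex.im_ofReal_mul]
  generalize hc : Real.cosh s = c at *
  generalize Real.sinh s = r at *
  have hc' : c = (c - ω.snd * r) + ω.snd * r := by ring
  generalize c - ω.snd * r = D at *
  rw [hc'] at hE ⊢
  field_simp
  linear_combination hE

theorem hdist_polar {ω : WithLp 2 (ℂ × ℝ)} (hω : ‖ω‖ = 1) {s : ℝ} (hs : 0 ≤ s) :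
    H3.hdist (polar ω hω s) H3.j = s := by
  have h := coshDist_polar hω s
  rw [← cosh_hdist] at h
  have h2 := congrArg Real.arcosh h
  rwa [Real.arcosh_cosh (hdist_nonneg _ _), Real.arcosh_cosh hs] at h2

theorem exists_unit : ∃ ω : WithLp 2 (ℂ × ℝ), ‖ω‖ = 1 := by
  refine ⟨WithLp.toLp 2 (0, 1), ?_⟩
  rw [← sq_eq_sq₀ (norm_nonneg _) zero_le_one, norm_sq_eq]
  simp

/-- The defining equations of `polar` are solved for `ω`: its last coordinate from `u`, the complex
one from `t`. That `ω` is a unit vector is `cosh² - sinh² = 1` together with `coshDist_j`. At `z =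
j` any direction serves. -/
theorem exists_polar (z : H3) : ∃ (ω : WithLp 2 (ℂ × ℝ)) (hω : ‖ω‖ = 1),
    z = polar ω hω (z.hdist H3.j) := by
  set s := z.hdist H3.j with hs
  have hc : Real.cosh s = (‖z.t‖ ^ 2 + z.u ^ 2 + 1) / (2 * z.u) := by
    rw [hs, cosh_hdist, coshDist_j]
  have hcs := Real.cosh_sq s
  have hpos := z.pos
  have hu := z.pos.ne'
  rcases (hdist_nonneg z H3.j).eq_or_lt with h0 | h0
  · rw [← hs] at h0
    obtain ⟨ω, hω⟩ := exists_unit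
    refine ⟨ω, hω, ?_⟩
    rw [← h0, Real.cosh_zero, eq_div_iff (by positivity)] at hc
    have h1 : ‖z.t‖ ^ 2 + (z.u - 1) ^ 2 = 0 := by linear_combination -hc
    have h2 : z.u - 1 = 0 := by
      have : (z.u - 1) ^ 2 = 0 := by nlinarith [sq_nonneg ‖z.t‖, sq_nonneg (z.u - 1)]
      simpa using this
    have h3 : z.t = 0 := by
      have : ‖z.t‖ ^ 2 = 0 := by nlinarith [sq_nonneg ‖z.t‖, sq_nonneg (z.u - 1)]
      simpa using this
    ext
    · simp [polar, ← h0, h3]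
    · simp [polar, ← h0]
      linarith
  · have hr : 0 < Real.sinh s := Real.sinh_pos_iff.mpr h0
    have hr' := hr.ne'
    rw [← Complex.normSq_eq_norm_sq, Complex.normSq_apply] at hc
    have hω : ‖(WithLp.toLp 2 (((1 / (z.u * Real.sinh s) : ℝ) : ℂ) * z.t,
        (Real.cosh s - 1 / z.u) / Real.sinh s) : WithLp 2 (ℂ × ℝ))‖ = 1 := by
      rw [← sq_eq_sq₀ (norm_nonneg _) zero_le_one, norm_sq_eq]
      change (((1 / (z.u * Real.sinh s) : ℝ) : ℂ) * z.t).re ^ 2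
        + (((1 / (z.u * Real.sinh s) : ℝ) : ℂ) * z.t).im ^ 2
        + ((Real.cosh s - 1 / z.u) / Real.sinh s) ^ 2 = 1 ^ 2
      rw [Complex.re_ofReal_mul, Complex.im_ofReal_mul]
      field_simp
      rw [eq_div_iff (by positivity)] at hc
      linear_combination z.u ^ 2 * hcs - hc
    refine ⟨_, hω, ?_⟩
    have e : Real.cosh s - (Real.cosh s - 1 / z.u) / Real.sinh s * Real.sinh s = 1 / z.u := by
      field_simp
      ring
    ext
    · change z.t = ((Real.sinh s / (Real.cosh s - (Real.cosh s - 1 / z.u) / Real.sinh s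
        * Real.sinh s) : ℝ) : ℂ) * (((1 / (z.u * Real.sinh s) : ℝ) : ℂ) * z.t)
      rw [e, ← mul_assoc, ← Complex.ofReal_mul]
      have : Real.sinh s / (1 / z.u) * (1 / (z.u * Real.sinh s)) = 1 := by field_simp
      rw [this]
      simp
    · change z.u = 1 / (Real.cosh s - (Real.cosh s - 1 / z.u) / Real.sinh s * Real.sinh s)
      rw [e, one_div_one_div]

theorem norm_spherePoint {p : ℂ × ℂ} (hp : p ≠ 0) : ‖spherePoint p‖ = 1 := by
  have hN := (pairNorm_pos hp).ne'
  rw [← sq_eq_sq₀ (norm_nonneg _) zero_le_one, norm_sq_eq, spherePoint_re, spherePoint_im,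
    spherePoint_snd]
  field_simp
  rw [pairNorm_eq]
  ring

/-- The chordal distance on the sphere is a normalized determinant; hence coinciding sphere points
come from proportional vectors. -/
theorem inner_spherePoint {p q : ℂ × ℂ} (hp : p ≠ 0) (hq : q ≠ 0) :
    (1 - inner ℝ (spherePoint p) (spherePoint q)) * (pairNorm p * pairNorm q)
      = 2 * ‖pairDet p q‖ ^ 2 := by
  have hN := (pairNorm_pos hp).ne'
  have hN' := (pairNorm_pos hq).ne'
  rw [inner_eq]
  simp only [spherePoint_re, spherePoint_im, spherePoint_snd]
  field_simp
  rw [pairNorm_eq, pairNorm_eq, ← Complex.normSq_eq_norm_sq, Complex.normSq_apply]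
  simp only [pairDet, Complex.sub_re, Complex.sub_im, Complex.mul_re, Complex.mul_im]
  ring

theorem pairDet_eq_zero_of_spherePoint_eq {p q : ℂ × ℂ} (hp : p ≠ 0) (hq : q ≠ 0)
    (h : spherePoint p = spherePoint q) : pairDet p q = 0 := by
  have := inner_spherePoint hp hq
  rw [h, real_inner_self_eq_norm_sq, norm_spherePoint hq] at this
  simpa using this

/-! ### The product of linear forms along rays -/

/-- AM-GM for the numbers `x k ^ n`. Under a circle average it separates a product into `n`-th
powers of single factors. -/
theorem prod_le_mean_of_pow {n : ℕ} (hn : n ≠ 0) {x : Fin n → ℝ} (hx : ∀ k, 0 ≤ x k) :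
    ∏ k, x k ≤ (∑ k, x k ^ n) / n := by
  have hn' : (n : ℝ) ≠ 0 := by exact_mod_cast hn
  have h := Real.geom_mean_le_arith_mean_weighted Finset.univ (fun _ : Fin n => (n : ℝ)⁻¹)
    (fun k => x k ^ n) (fun _ _ => by positivity) (by simp [hn']) (fun k _ => pow_nonneg (hx k) n)
  have e : ∀ k, (x k ^ n) ^ (n : ℝ)⁻¹ = x k := fun k => Real.pow_rpow_inv_natCast (hx k) hn
  simp only [e, ← Finset.mul_sum] at h
  rwa [inv_mul_eq_div] at h

theorem prod_le_pow_mean {n : ℕ} (hn : n ≠ 0) {x : Fin n → ℝ} (hx : ∀ k, 0 ≤ x k) :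
    ∏ k, x k ≤ ((∑ k, x k) / n) ^ n := by
  have hn' : (n : ℝ) ≠ 0 := by exact_mod_cast hn
  have h := Real.geom_mean_le_arith_mean_weighted Finset.univ (fun _ : Fin n => (n : ℝ)⁻¹)
    x (fun _ _ => by positivity) (by simp [hn']) (fun k _ => hx k)
  rw [← Finset.mul_sum, inv_mul_eq_div, Real.finsetProd_rpow _ _ (fun k _ => hx k)] at h
  have h2 := pow_le_pow_left₀ (Real.rpow_nonneg (Finset.prod_nonneg fun k _ => hx k) _) h n
  rwa [Real.rpow_inv_natCast_pow (Finset.prod_nonneg fun k _ => hx k) hn] at h2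

variable {n : ℕ}

/-- The ratio `R(F, z) / R(F, j)` at the point `z` at distance `s` from `j` in direction `ω`,
in terms of the points `φₖ` of the sphere. -/
def growth (φ : Fin n → WithLp 2 (ℂ × ℝ)) (ω : WithLp 2 (ℂ × ℝ)) (s : ℝ) : ℝ :=
  ∏ k, (Real.cosh s - inner ℝ ω (φ k) * Real.sinh s)

theorem growth_zero (φ : Fin n → WithLp 2 (ℂ × ℝ)) (ω : WithLp 2 (ℂ × ℝ)) :
    growth φ ω 0 = 1 := by
  simp [growth]

theorem continuous_growth (φ : Fin n → WithLp 2 (ℂ × ℝ)) :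
    Continuous fun x : WithLp 2 (ℂ × ℝ) × ℝ => growth φ x.1 x.2 := by
  unfold growth
  fun_prop

theorem growth_pos {φ : Fin n → WithLp 2 (ℂ × ℝ)} (hφ : ∀ k, ‖φ k‖ = 1)
    {ω : WithLp 2 (ℂ × ℝ)} (hω : ‖ω‖ = 1) (s : ℝ) : 0 < growth φ ω s :=
  Finset.prod_pos fun k _ => cosh_sub_mul_sinh_pos (abs_inner_le_one hω (hφ k)) s

/-- Exponential growth along rays, uniformly in the direction. -/
theorem exists_growth_ge {φ : Fin n → WithLp 2 (ℂ × ℝ)} (hφ : ∀ k, ‖φ k‖ = 1) (m : ℕ)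
    (hm : ∀ ω : WithLp 2 (ℂ × ℝ), ‖ω‖ = 1 → ∃ S : Finset (Fin n), m ≤ S.card ∧
      (∀ k ∈ S, φ k ≠ ω) ∧ ∀ k ∉ S, φ k = ω) :
    ∃ c : ℝ, 0 < c ∧ ∀ ω : WithLp 2 (ℂ × ℝ), ‖ω‖ = 1 → ∀ s : ℝ, 0 ≤ s →
      c * Real.exp ((2 * m - n) * s) ≤ growth φ ω s := by
  -- Each factor of `growth` is `(1 - a)/2 * e^s + (1 + a)/2 * e^(-s)` with `a = ⟨ω, φₖ⟩`. Expanding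
  -- the product, `S` records the factors contributing `e^s`, and `G` sums the coefficients with
  -- `|S| ≥ m`; the remaining nonnegative terms are discarded.
  set G : WithLp 2 (ℂ × ℝ) → ℝ := fun ω =>
    ∑ S ∈ (Finset.univ : Finset (Fin n)).powerset with m ≤ S.card,
      (∏ k ∈ S, (1 - inner ℝ ω (φ k)) / 2) * ∏ k ∈ Finset.univ \ S, (1 + inner ℝ ω (φ k)) / 2
    with hG
  have hG_cont : Continuous G := by
    rw [hG]
    fun_prop
  have hle : ∀ ω : WithLp 2 (ℂ × ℝ), ‖ω‖ = 1 → ∀ k,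
      0 ≤ (1 - inner ℝ ω (φ k)) / 2 ∧ 0 ≤ (1 + inner ℝ ω (φ k)) / 2 := by
    intro ω hω k
    have := abs_le.mp (abs_inner_le_one hω (hφ k))
    constructor <;> linarith
  have hterm : ∀ ω : WithLp 2 (ℂ × ℝ), ‖ω‖ = 1 → ∀ S : Finset (Fin n),
      0 ≤ (∏ k ∈ S, (1 - inner ℝ ω (φ k)) / 2) *
        ∏ k ∈ Finset.univ \ S, (1 + inner ℝ ω (φ k)) / 2 := fun ω hω S =>
    mul_nonneg (Finset.prod_nonneg fun k _ => (hle ω hω k).1)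
      (Finset.prod_nonneg fun k _ => (hle ω hω k).2)
  have hG_pos : ∀ ω : WithLp 2 (ℂ × ℝ), ‖ω‖ = 1 → 0 < G ω := by
    intro ω hω
    -- For the set of all `k` with `φ k ≠ ω`, no factor of the coefficient vanishes: outside it, `(1
    -- + 1)/2 = 1`.
    obtain ⟨S, hS, hS1, hS2⟩ := hm ω hω
    refine Finset.sum_pos' (fun S _ => hterm ω hω S) ⟨S, by simpa using hS, ?_⟩
    refine mul_pos (Finset.prod_pos fun k hk => ?_) (Finset.prod_pos fun k hk => ?_)
    · have h1 := (abs_le.mp (abs_inner_le_one hω (hφ k))).2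
      have h2 : inner ℝ ω (φ k) ≠ 1 := fun h =>
        hS1 k hk ((inner_eq_one_iff_of_norm_eq_one (𝕜 := ℝ) hω (hφ k)).mp h).symm
      have := lt_of_le_of_ne h1 h2
      linarith
    · rw [hS2 k (by simpa using hk), real_inner_self_eq_norm_sq, hω]
      norm_num
  obtain ⟨ω₀, hω₀, hmin⟩ := (isCompact_sphere (0 : WithLp 2 (ℂ × ℝ)) 1).exists_isMinOn
    (by obtain ⟨ω, hω⟩ := exists_unit; exact ⟨ω, by simpa using hω⟩) hG_cont.continuousOn
  refine ⟨G ω₀, hG_pos _ (by simpa using hω₀), fun ω hω s hs => ?_⟩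
  have hGle : G ω₀ ≤ G ω := hmin (by simpa using hω)
  refine (mul_le_mul_of_nonneg_right hGle (Real.exp_pos _).le).trans ?_
  have hexp : ∀ k, Real.cosh s - inner ℝ ω (φ k) * Real.sinh s
      = (1 - inner ℝ ω (φ k)) / 2 * Real.exp s + (1 + inner ℝ ω (φ k)) / 2 * Real.exp (-s) := by
    intro k
    rw [Real.cosh_eq, Real.sinh_eq]
    ring
  unfold growth
  simp only [hexp]
  rw [Finset.prod_add, hG, Finset.sum_mul]
  refine (Finset.sum_le_sum fun S hS => ?_).trans
    (Finset.sum_le_sum_of_subset_of_nonneg (Finset.filter_subset _ _) fun S _ _ => ?_)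
  · have hS' : m ≤ S.card := (Finset.mem_filter.mp hS).2
    rw [Finset.prod_mul_distrib, Finset.prod_mul_distrib, Finset.prod_const, Finset.prod_const,
      mul_mul_mul_comm, ← Real.exp_nat_mul, ← Real.exp_nat_mul, ← Real.exp_add]
    refine mul_le_mul_of_nonneg_left (Real.exp_le_exp.mpr ?_) (hterm ω hω S)
    have hc : ((Finset.univ \ S).card : ℝ) = n - S.card := by
      rw [Finset.card_sdiff_of_subset (Finset.subset_univ S), Finset.card_univ, Fintype.card_fin,
        Nat.cast_sub (by simpa using S.card_le_univ)]
    have hS'' : (m : ℝ) ≤ S.card := by exact_mod_cast hS'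
    rw [hc]
    nlinarith
  · rw [Finset.prod_mul_distrib, Finset.prod_mul_distrib, mul_mul_mul_comm]
    refine mul_nonneg (hterm ω hω S) ?_
    simp only [Finset.prod_const]
    positivity

theorem hasDerivAt_growth (φ : Fin n → WithLp 2 (ℂ × ℝ)) (ω : WithLp 2 (ℂ × ℝ)) (s : ℝ) :
    HasDerivAt (growth φ ω) (∑ k, (∏ l ∈ Finset.univ.erase k,
      (Real.cosh s - inner ℝ ω (φ l) * Real.sinh s)) *
        (Real.sinh s - inner ℝ ω (φ k) * Real.cosh s)) s := by
  have h := HasDerivAt.fun_finsetProd (u := Finset.univ) (x := s)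
    (f := fun k s => Real.cosh s - inner ℝ ω (φ k) * Real.sinh s)
    (f' := fun k => Real.sinh s - inner ℝ ω (φ k) * Real.cosh s)
    (fun k _ => (Real.hasDerivAt_cosh s).sub ((Real.hasDerivAt_sinh s).const_mul _))
  exact h

/-- If `j` is a minimizer, then the points on the sphere have barycenter zero. -/
theorem sum_eq_zero_of_one_le_growth {φ : Fin n → WithLp 2 (ℂ × ℝ)}
    (h : ∀ ω : WithLp 2 (ℂ × ℝ), ‖ω‖ = 1 → ∀ s, 1 ≤ growth φ ω s) : ∑ k, φ k = 0 := by
  have key : ∀ ω : WithLp 2 (ℂ × ℝ), ‖ω‖ = 1 → inner ℝ ω (∑ k, φ k) = 0 := by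
    intro ω hω
    -- The hypothesis covers negative `s` too, so `0` is an interior minimum; the derivative there
    -- is `-⟨ω, ∑ φₖ⟩`.
    have hmin : IsLocalMin (growth φ ω) 0 :=
      Filter.Eventually.of_forall fun s => by rw [growth_zero]; exact h ω hω s
    have := hmin.hasDerivAt_eq_zero (hasDerivAt_growth φ ω 0)
    simpa only [Real.sinh_zero, Real.cosh_zero, mul_zero, sub_zero, Finset.prod_const_one, one_mul,
      mul_one, zero_sub, Finset.sum_neg_distrib, neg_eq_zero, ← inner_sum] using this
  by_contra hne
  have h1 := key (‖∑ k, φ k‖⁻¹ • ∑ k, φ k) (norm_smul_inv_norm hne)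
  rw [real_inner_smul_left, real_inner_self_eq_norm_sq] at h1
  have := norm_ne_zero_iff.mpr hne
  simp [this] at h1

/-- With `a = ⟨ω, φₖ⟩`, the logarithmic derivative of a factor is `sinh s (1 - a²) / (cosh s - a
sinh s) - a`. The terms `-a` cancel in the sum because the barycenter is zero; the rest is
nonnegative, and positive for a point other than `±ω`. -/
theorem strictMonoOn_growth {φ : Fin n → WithLp 2 (ℂ × ℝ)} (hφ : ∀ k, ‖φ k‖ = 1)
    (hsum : ∑ k, φ k = 0) {ω : WithLp 2 (ℂ × ℝ)} (hω : ‖ω‖ = 1)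
    (hk : ∃ k, φ k ≠ ω ∧ φ k ≠ -ω) : StrictMonoOn (growth φ ω) (Set.Ici 0) := by
  have hcont : Continuous (growth φ ω) := by
    unfold growth
    fun_prop
  refine strictMonoOn_of_deriv_pos (convex_Ici 0) hcont.continuousOn fun s hs => ?_
  rw [interior_Ici] at hs
  have hs : 0 < s := hs
  have hsh : 0 < Real.sinh s := Real.sinh_pos_iff.mpr hs
  rw [(hasDerivAt_growth φ ω s).deriv]
  have hpos : ∀ k, 0 < Real.cosh s - inner ℝ ω (φ k) * Real.sinh s := fun k =>
    cosh_sub_mul_sinh_pos (abs_inner_le_one hω (hφ k)) s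
  have e : ∀ k, (∏ l ∈ Finset.univ.erase k, (Real.cosh s - inner ℝ ω (φ l) * Real.sinh s)) *
        (Real.sinh s - inner ℝ ω (φ k) * Real.cosh s)
      = growth φ ω s * (Real.sinh s * (1 - inner ℝ ω (φ k) ^ 2)
          / (Real.cosh s - inner ℝ ω (φ k) * Real.sinh s)) - growth φ ω s * inner ℝ ω (φ k) := by
    intro k
    have h1 : growth φ ω s = (Real.cosh s - inner ℝ ω (φ k) * Real.sinh s) *
        ∏ l ∈ Finset.univ.erase k, (Real.cosh s - inner ℝ ω (φ l) * Real.sinh s) :=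
      (Finset.mul_prod_erase Finset.univ _ (Finset.mem_univ k)).symm
    rw [h1]
    have h2 := (hpos k).ne'
    generalize (∏ l ∈ Finset.univ.erase k, _ : ℝ) = P
    generalize inner ℝ ω (φ k) = a at h2 ⊢
    rw [mul_comm _ P, mul_assoc, mul_div_cancel₀ _ h2]
    ring
  rw [Finset.sum_congr rfl fun k _ => e k, Finset.sum_sub_distrib, ← Finset.mul_sum,
    ← Finset.mul_sum, ← inner_sum, hsum, inner_zero_right, mul_zero, sub_zero]
  refine mul_pos (growth_pos hφ hω s) (Finset.sum_pos' (fun k _ => ?_) ?_)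
  · have := (sq_le_one_iff_abs_le_one _).mpr (abs_inner_le_one hω (hφ k))
    exact div_nonneg (mul_nonneg hsh.le (by linarith)) (hpos k).le
  · obtain ⟨k, h1, h2⟩ := hk
    refine ⟨k, Finset.mem_univ k, div_pos (mul_pos hsh ?_) (hpos k)⟩
    have h3 : inner ℝ ω (φ k) ≠ 1 := fun h =>
      h1 ((inner_eq_one_iff_of_norm_eq_one (𝕜 := ℝ) hω (hφ k)).mp h).symm
    have h4 : inner ℝ ω (φ k) ≠ -1 := fun h => by
      have h5 : inner ℝ (-ω) (φ k) = 1 := by rw [inner_neg_left, h, neg_neg]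
      exact h2 ((inner_eq_one_iff_of_norm_eq_one (𝕜 := ℝ) (by simpa using hω) (hφ k)).mp h5).symm
    have h5 := abs_le.mp (abs_inner_le_one hω (hφ k))
    have h6 := lt_of_le_of_ne h5.2 h3
    have h7 := lt_of_le_of_ne h5.1 h4.symm
    nlinarith

/-- AM-GM: since the barycenter is zero, the factors have mean `cosh s`. -/
theorem growth_le_cosh_pow (hn : n ≠ 0) {φ : Fin n → WithLp 2 (ℂ × ℝ)} (hφ : ∀ k, ‖φ k‖ = 1)
    (hsum : ∑ k, φ k = 0) {ω : WithLp 2 (ℂ × ℝ)} (hω : ‖ω‖ = 1) (s : ℝ) :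
    growth φ ω s ≤ Real.cosh s ^ n := by
  have h := prod_le_pow_mean hn (x := fun k => Real.cosh s - inner ℝ ω (φ k) * Real.sinh s)
    fun k => (cosh_sub_mul_sinh_pos (abs_inner_le_one hω (hφ k)) s).le
  have hn' : (n : ℝ) ≠ 0 := by exact_mod_cast hn
  rwa [Finset.sum_sub_distrib, ← Finset.sum_mul, ← inner_sum, hsum, inner_zero_right, zero_mul,
    sub_zero, Finset.sum_const, Finset.card_univ, Fintype.card_fin, nsmul_eq_mul,
    mul_div_cancel_left₀ _ hn'] at h

/-! ### Minimal growth over all directions. -/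

/-- The least growth at distance `δ` over all directions. -/
def minGrowth (φ : Fin n → WithLp 2 (ℂ × ℝ)) (δ : ℝ) : ℝ :=
  sInf ((fun ω => growth φ ω δ) '' Metric.sphere 0 1)

theorem isLeast_minGrowth (φ : Fin n → WithLp 2 (ℂ × ℝ)) (δ : ℝ) :
    IsLeast ((fun ω => growth φ ω δ) '' Metric.sphere 0 1) (minGrowth φ δ) := by
  refine IsCompact.isLeast_sInf (IsCompact.image (isCompact_sphere _ _) ?_) (Set.Nonempty.image _ ?_)
  · exact (continuous_growth φ).comp (Continuous.prodMk continuous_id continuous_const)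
  · obtain ⟨ω, hω⟩ := exists_unit
    exact ⟨ω, by simpa using hω⟩

theorem continuous_minGrowth (φ : Fin n → WithLp 2 (ℂ × ℝ)) : Continuous (minGrowth φ) :=
  IsCompact.continuous_sInf (f := fun δ ω => growth φ ω δ) (isCompact_sphere _ _)
    ((continuous_growth φ).comp continuous_swap)

theorem minGrowth_le (φ : Fin n → WithLp 2 (ℂ × ℝ)) (δ : ℝ) {ω : WithLp 2 (ℂ × ℝ)}
    (hω : ‖ω‖ = 1) : minGrowth φ δ ≤ growth φ ω δ :=
  (isLeast_minGrowth φ δ).2 ⟨ω, by simpa using hω, rfl⟩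

theorem exists_growth_eq_minGrowth (φ : Fin n → WithLp 2 (ℂ × ℝ)) (δ : ℝ) :
    ∃ ω : WithLp 2 (ℂ × ℝ), ‖ω‖ = 1 ∧ growth φ ω δ = minGrowth φ δ := by
  obtain ⟨ω, hω, h⟩ := (isLeast_minGrowth φ δ).1
  exact ⟨ω, by simpa using hω, h⟩

theorem minGrowth_zero (φ : Fin n → WithLp 2 (ℂ × ℝ)) : minGrowth φ 0 = 1 := by
  obtain ⟨ω, hω, h⟩ := exists_growth_eq_minGrowth φ 0
  rw [← h, growth_zero]

theorem strictMonoOn_minGrowth {φ : Fin n → WithLp 2 (ℂ × ℝ)} (hφ : ∀ k, ‖φ k‖ = 1)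
    (hsum : ∑ k, φ k = 0)
    (hk : ∀ ω : WithLp 2 (ℂ × ℝ), ‖ω‖ = 1 → ∃ k, φ k ≠ ω ∧ φ k ≠ -ω) :
    StrictMonoOn (minGrowth φ) (Set.Ici 0) := by
  intro a ha b hb hab
  obtain ⟨ω, hω, h⟩ := exists_growth_eq_minGrowth φ b
  rw [← h]
  exact (minGrowth_le φ a hω).trans_lt (strictMonoOn_growth hφ hsum hω (hk ω hω) ha hb hab)

theorem bijOn_minGrowth {φ : Fin n → WithLp 2 (ℂ × ℝ)}
    (hmono : StrictMonoOn (minGrowth φ) (Set.Ici 0)) {c : ℝ} (hc : 0 < c)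
    (hlow : ∀ ω : WithLp 2 (ℂ × ℝ), ‖ω‖ = 1 → ∀ s : ℝ, 0 ≤ s → c * Real.exp s ≤ growth φ ω s) :
    Set.BijOn (minGrowth φ) (Set.Ici 0) (Set.Ici 1) := by
  refine ⟨fun δ hδ => ?_, hmono.injOn, fun y hy => ?_⟩
  · have := hmono.monotoneOn (Set.self_mem_Ici (a := (0 : ℝ))) hδ hδ
    rwa [minGrowth_zero] at this
  · have hy : 1 ≤ y := hy
    -- Large enough, as `c e^d ≥ c (d + 1) ≥ y`; the intermediate value theorem then applies on `[0,
    -- d]`.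
    set d := max 0 (y / c) with hd
    have hd0 : 0 ≤ d := le_max_left _ _
    have h1 : y ≤ minGrowth φ d := by
      obtain ⟨ω, hω, h⟩ := exists_growth_eq_minGrowth φ d
      rw [← h]
      refine le_trans ?_ (hlow ω hω d hd0)
      have h2 : y / c ≤ Real.exp d := by
        have := Real.add_one_le_exp d
        have := le_max_right 0 (y / c)
        linarith
      rw [div_le_iff₀ hc] at h2
      linarith
    obtain ⟨x, hx, hxy⟩ := intermediate_value_Icc hd0 (continuous_minGrowth φ).continuousOn
      (show y ∈ Set.Icc _ _ from ⟨by rwa [minGrowth_zero], h1⟩)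
    exact ⟨x, hx.1, hxy⟩

/-! ### The size of a form and its linear factors -/

/-- By homogeneity the exponent of `x` determines that of `y`, so setting `y = 1` merges no
coefficients. This gives access to Parseval's identity in one variable. -/
theorem size_eq_sum_dehom {n : ℕ} {F : MvPolynomial (Fin 2) ℂ} (hF : F.IsHomogeneous n) :
    size F = ∑ i ∈ (dehom F).support, ‖(dehom F).coeff i‖ ^ 2 := by
  have hdeg : ∀ m ∈ F.support, m 0 + m 1 = n := by
    intro m hm
    have := hF (MvPolynomial.mem_support_iff.mp hm)
    rw [Finsupp.weight_apply, Finsupp.sum_fintype _ _ (by simp)] at this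
    simpa [Fin.sum_univ_two] using this
  have hinj : ∀ m ∈ F.support, ∀ m' ∈ F.support, m 0 = m' 0 → m = m' := by
    intro m hm m' hm' h
    have h1 := hdeg m hm
    have h2 := hdeg m' hm'
    ext i
    fin_cases i
    · exact h
    · change m 1 = m' 1
      omega
  have hcoeff : ∀ i, (dehom F).coeff i = ∑ m ∈ F.support, if i = m 0 then F.coeff m else 0 := by
    intro i
    rw [dehom, MvPolynomial.aeval_def, MvPolynomial.eval₂_eq', Polynomial.finsetSum_coeff]
    refine Finset.sum_congr rfl fun m _ => ?_
    simp [Polynomial.coeff_X_pow]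
  have hc : ∀ m ∈ F.support, (dehom F).coeff (m 0) = F.coeff m := by
    intro m hm
    rw [hcoeff, Finset.sum_eq_single m]
    · simp
    · intro m' hm' hne
      rw [if_neg fun h => hne (hinj m hm m' hm' h).symm]
    · exact fun h => absurd hm h
  refine Finset.sum_bij (fun m _ => m 0) ?_ ?_ ?_ ?_
  · intro m hm
    rw [Polynomial.mem_support_iff, hc m hm]
    exact MvPolynomial.mem_support_iff.mp hm
  · intro m hm m' hm' h
    exact hinj m hm m' hm' h
  · intro i hi
    rw [Polynomial.mem_support_iff, hcoeff] at hi
    obtain ⟨m, hm, h⟩ := Finset.exists_ne_zero_of_sum_ne_zero hi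
    refine ⟨m, hm, ?_⟩
    by_contra hne
    exact h (if_neg fun h => hne h.symm)
  · intro m hm
    rw [hc m hm]

theorem prod_linForm_isHomogeneous (p : Fin n → ℂ × ℂ) :
    (∏ k, linForm (p k)).IsHomogeneous n := by
  have h1 := MvPolynomial.IsHomogeneous.prod (Finset.univ : Finset (Fin n))
    (fun k => linForm (p k)) (fun _ => 1) (fun k _ => linForm_isHomogeneous _)
  simpa using h1

theorem dehom_prod_linForm (p : Fin n → ℂ × ℂ) : dehom (∏ k, linForm (p k))
    = ∏ k, (Polynomial.C (p k).2 * Polynomial.X - Polynomial.C (p k).1) := by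
  rw [map_prod]
  exact Finset.prod_congr rfl fun k _ => dehom_linForm _

/-- Parseval's identity for a product of linear forms. -/
theorem size_prod_eq_circleAverage (p : Fin n → ℂ × ℂ) :
    size (∏ k, linForm (p k))
      = Real.circleAverage (fun ζ => ∏ k, ‖(p k).2 * ζ - (p k).1‖ ^ 2) 0 1 := by
  rw [size_eq_sum_dehom (prod_linForm_isHomogeneous p),
    Polynomial.sum_sq_norm_coeff_eq_circleAverage, dehom_prod_linForm]
  congr 1
  ext ζ
  simp [Polynomial.eval_prod, Finset.prod_pow]

/-- The pair of the linear form `conj α x - conj β y`, which has the same absolute value as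
`β x - α y` when `|x| = |y| = 1`. -/
def flipPair (p : ℂ × ℂ) : ℂ × ℂ := (conj p.2, conj p.1)

theorem norm_flipPair {ζ : ℂ} (hζ : ‖ζ‖ = 1) (p : ℂ × ℂ) :
    ‖(flipPair p).2 * ζ - (flipPair p).1‖ = ‖p.2 * ζ - p.1‖ := by
  have h : ζ * conj ζ = 1 := by rw [Complex.mul_conj', hζ]; simp
  have e : (flipPair p).2 * ζ - (flipPair p).1 = -(ζ * conj (p.2 * ζ - p.1)) := by
    simp only [flipPair, map_sub, map_mul]
    linear_combination (conj p.2) * h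
  rw [e, norm_neg, norm_mul, hζ, one_mul, Complex.norm_conj]

theorem norm_eq_one_of_mem_sphere {ζ : ℂ} (h : ζ ∈ Metric.sphere (0 : ℂ) |1|) : ‖ζ‖ = 1 := by
  simpa using h

/-- By Parseval the size depends only on the absolute values of the factors on the unit circle,
which flipping preserves. -/
theorem size_flip (p : Fin n → ℂ × ℂ) (S : Finset (Fin n)) :
    size (∏ k, linForm (if k ∈ S then flipPair (p k) else p k)) = size (∏ k, linForm (p k)) := by
  rw [size_prod_eq_circleAverage, size_prod_eq_circleAverage]
  refine Real.circleAverage_congr_sphere fun ζ hζ => Finset.prod_congr rfl fun k _ => ?_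
  split_ifs
  · rw [norm_flipPair (norm_eq_one_of_mem_sphere hζ)]
  · rfl

/-- Only the coefficients of `x^n` and `y^n` are kept; they are distinct because `n ≠ 0`. -/
theorem extreme_coeff_le_size (hn : n ≠ 0) (p : Fin n → ℂ × ℂ) :
    ∏ k, ‖(p k).1‖ ^ 2 + ∏ k, ‖(p k).2‖ ^ 2 ≤ size (∏ k, linForm (p k)) := by
  rw [size_eq_sum_dehom (prod_linForm_isHomogeneous p), dehom_prod_linForm]
  set f := ∏ k, (Polynomial.C (p k).2 * Polynomial.X - Polynomial.C (p k).1) with hf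
  have h0 : f.coeff 0 = ∏ k, (-(p k).1) := by
    rw [Polynomial.coeff_zero_eq_eval_zero, hf, Polynomial.eval_prod]
    simp
  have h1 : f.coeff n = ∏ k, (p k).2 := by
    have := Polynomial.coeff_prod_of_natDegree_le (Finset.univ : Finset (Fin n))
      (fun k => Polynomial.C (p k).2 * Polynomial.X - Polynomial.C (p k).1) 1
      (fun k _ => by compute_degree)
    simpa [Polynomial.coeff_C] using this
  have hsum : ∑ i ∈ f.support, ‖f.coeff i‖ ^ 2 = ∑ i ∈ f.support ∪ {0, n}, ‖f.coeff i‖ ^ 2 := by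
    refine Finset.sum_subset Finset.subset_union_left fun i _ hi => ?_
    rw [Polynomial.notMem_support_iff.mp hi]
    simp
  rw [hsum]
  refine le_trans (le_of_eq ?_) (Finset.sum_le_sum_of_subset_of_nonneg
    (Finset.subset_union_right : {0, n} ⊆ f.support ∪ {0, n}) fun i _ _ => by positivity)
  rw [Finset.sum_pair hn.symm, h0, h1]
  simp [Finset.prod_pow]

/-- `∏ (|αₖ|² + |βₖ|²) ≤ 2 ^ (n - 1) ‖F‖`. -/
theorem prod_pairNorm_le_size (hn : n ≠ 0) (p : Fin n → ℂ × ℂ) :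
    2 * ∏ k, pairNorm (p k) ≤ 2 ^ n * size (∏ k, linForm (p k)) := by
  -- Flipping the factors in `S` turns the two extreme coefficients into the terms of `S` and of its
  -- complement in the expansion of `∏ (|αₖ|² + |βₖ|²)`. Summing over all `2 ^ n` sets counts that
  -- product twice.
  have key : ∀ S : Finset (Fin n),
      (∏ k ∈ S, ‖(p k).1‖ ^ 2) * (∏ k ∈ Finset.univ \ S, ‖(p k).2‖ ^ 2)
      + (∏ k ∈ S, ‖(p k).2‖ ^ 2) * (∏ k ∈ Finset.univ \ S, ‖(p k).1‖ ^ 2)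
        ≤ size (∏ k, linForm (p k)) := by
    intro S
    have h := extreme_coeff_le_size hn (fun k => if k ∈ S then flipPair (p k) else p k)
    rw [size_flip] at h
    refine le_trans (le_of_eq ?_) h
    have e : ∀ f g : Fin n → ℝ, (∏ k ∈ S, f k) * ∏ k ∈ Finset.univ \ S, g k
        = ∏ k, if k ∈ S then f k else g k := by
      intro f g
      rw [Finset.prod_ite]
      congr 1
      · exact Finset.prod_congr (by ext; simp) fun _ _ => rfl
      · exact Finset.prod_congr (by ext; simp) fun _ _ => rfl
    rw [e, e, add_comm]
    congr 1 <;>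
    · refine Finset.prod_congr rfl fun k _ => ?_
      split_ifs <;> simp [flipPair]
  have h1 : ∏ k, pairNorm (p k) = ∑ S ∈ (Finset.univ : Finset (Fin n)).powerset,
      (∏ k ∈ S, ‖(p k).1‖ ^ 2) * ∏ k ∈ Finset.univ \ S, ‖(p k).2‖ ^ 2 :=
    Finset.prod_add _ _ _
  have h2 : ∏ k, pairNorm (p k) = ∑ S ∈ (Finset.univ : Finset (Fin n)).powerset,
      (∏ k ∈ S, ‖(p k).2‖ ^ 2) * ∏ k ∈ Finset.univ \ S, ‖(p k).1‖ ^ 2 := by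
    rw [← Finset.prod_add]
    exact Finset.prod_congr rfl fun k _ => add_comm _ _
  rw [two_mul]
  nth_rw 1 [h1]
  rw [h2, ← Finset.sum_add_distrib]
  refine (Finset.sum_le_card_nsmul _ _ _ fun S _ => key S).trans (le_of_eq ?_)
  simp

/-! ### Upper bound for the size, by comparison with `(x - e y)^n`. -/

/-- Odd powers cancel in the binomial expansion, and even powers grow with the absolute value. -/
theorem pow_add_pow_le {r c : ℝ} (hr : |r| ≤ |c|) (m : ℕ) :
    (1 - r) ^ m + (1 + r) ^ m ≤ (1 - c) ^ m + (1 + c) ^ m := by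
  have e : ∀ x : ℝ, (1 - x) ^ m + (1 + x) ^ m
      = ∑ i ∈ Finset.range (m + 1), ((-x) ^ i + x ^ i) * m.choose i := by
    intro x
    rw [sub_eq_neg_add, add_comm 1 x, add_pow, add_pow, ← Finset.sum_add_distrib]
    refine Finset.sum_congr rfl fun i _ => ?_
    rw [one_pow]
    ring
  rw [e, e]
  refine Finset.sum_le_sum fun i _ => mul_le_mul_of_nonneg_right ?_ (Nat.cast_nonneg _)
  rcases Nat.even_or_odd i with hi | hi
  · have := pow_le_pow_left₀ (abs_nonneg r) hr i
    rw [hi.pow_abs, hi.pow_abs] at this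
    rw [hi.neg_pow, hi.neg_pow]
    linarith
  · rw [hi.neg_pow, hi.neg_pow]
    simp

theorem size_pow_linear (n : ℕ) {e : ℂ} (he : ‖e‖ = 1) :
    size (∏ _k : Fin n, linForm (e, 1)) = (2 * n).choose n := by
  rw [size_eq_sum_dehom (prod_linForm_isHomogeneous _), dehom_prod_linForm]
  have h1 : (∏ _k : Fin n, (Polynomial.C (1 : ℂ) * Polynomial.X - Polynomial.C e))
      = (Polynomial.X + Polynomial.C (-e)) ^ n := by
    simp [sub_eq_add_neg]
  simp only [h1]
  have h2 : ∀ i, ‖((Polynomial.X + Polynomial.C (-e)) ^ n).coeff i‖ ^ 2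
      = ((n.choose i ^ 2 : ℕ) : ℝ) := by
    intro i
    rw [Polynomial.coeff_X_add_C_pow]
    simp [he]
  rw [← Nat.sum_range_choose_sq, Nat.cast_sum]
  refine (Finset.sum_congr rfl fun i _ => h2 i).trans (Finset.sum_subset (fun i hi => ?_)
    fun i _ hi => ?_)
  · have := Polynomial.le_natDegree_of_mem_supp i hi
    rw [Polynomial.natDegree_pow_X_add_C] at this
    exact Finset.mem_range_succ_iff.mpr this
  · rw [← h2, Polynomial.notMem_support_iff.mp hi]
    simp

theorem circleAverage_comp_neg (f : ℂ → ℝ) :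
    Real.circleAverage (fun ζ => f (-ζ)) 0 1 = Real.circleAverage f 0 1 := by
  rw [Real.circleAverage_eq_integral_add Real.pi (f := f), Real.circleAverage_def]
  congr 2
  ext θ
  simp [circleMap, add_mul, Complex.exp_add]

theorem exists_unit_mul_norm (w : ℂ) : ∃ e : ℂ, ‖e‖ = 1 ∧ w = ‖w‖ * e :=
  ⟨Complex.exp (w.arg * Complex.I), Complex.norm_exp_ofReal_mul_I _,
    (Complex.norm_mul_exp_arg_mul_I w).symm⟩

/-- The squared absolute value of a normalized linear form on the unit circle, minus one. -/
def deviation (p : ℂ × ℂ) (ζ : ℂ) : ℝ := 2 * (p.2 * conj p.1 * ζ).re / pairNorm p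

theorem norm_sq_eq_deviation {p : ℂ × ℂ} (hp : p ≠ 0) {ζ : ℂ} (hζ : ‖ζ‖ = 1) :
    ‖p.2 * ζ - p.1‖ ^ 2 = pairNorm p * (1 - deviation p ζ) := by
  have hN := (pairNorm_pos hp).ne'
  have h1 : ‖ζ‖ ^ 2 = 1 := by rw [hζ, one_pow]
  have e : pairNorm p * (1 - deviation p ζ) = pairNorm p - 2 * (p.2 * conj p.1 * ζ).re := by
    unfold deviation
    field_simp
  rw [e]
  unfold pairNorm
  simp only [← Complex.normSq_eq_norm_sq, Complex.normSq_apply] at h1 ⊢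
  simp
  linear_combination (p.2.re ^ 2 + p.2.im ^ 2) * h1

theorem continuous_deviation (p : ℂ × ℂ) : Continuous (deviation p) := by
  unfold deviation
  fun_prop

/-- Averaging over `ζ` and `-ζ` makes the integrand even in `deviation`, hence increasing in its
amplitude `2|αβ| / (|α|² + |β|²) ≤ 1`. The extreme case is `|α| = |β|`, represented by `(e, 1)`: the
form `(x - e y)^n` has size `(2n choose n)`, and `pairNorm (e, 1) = 2` accounts for `2 ^ (-n)`. -/
theorem circleAverage_deviation_le {p : ℂ × ℂ} (hp : p ≠ 0) :
    Real.circleAverage (fun ζ => (1 - deviation p ζ) ^ n) 0 1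
      ≤ (2 : ℝ) ^ (-(n : ℤ)) * (2 * n).choose n := by
  have hint : ∀ f : ℂ → ℝ, Continuous f → CircleIntegrable f 0 1 := fun f hf =>
    hf.continuousOn.circleIntegrable zero_le_one
  have hsym : ∀ q : ℂ × ℂ, Real.circleAverage (fun ζ => (1 - deviation q ζ) ^ n) 0 1
      = Real.circleAverage
        (fun ζ => ((1 - deviation q ζ) ^ n + (1 + deviation q ζ) ^ n) / 2) 0 1 := by
    intro q
    have hc := continuous_deviation q
    have h1 := circleAverage_comp_neg fun ζ => (1 - deviation q ζ) ^ n
    have e : ∀ ζ, deviation q (-ζ) = -deviation q ζ := fun ζ => by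
      simp [deviation]
      ring
    simp only [e, sub_neg_eq_add] at h1
    have h2 := Real.circleAverage_fun_add (hint (fun ζ => (1 - deviation q ζ) ^ n) (by fun_prop))
      (hint (fun ζ => (1 + deviation q ζ) ^ n) (by fun_prop))
    have h3 := Real.circleAverage_fun_smul (𝕜 := ℝ) (a := (1 / 2 : ℝ)) (c := 0) (R := 1)
      (f := fun ζ => (1 - deviation q ζ) ^ n + (1 + deviation q ζ) ^ n)
    rw [h2, h1] at h3
    simp only [smul_eq_mul] at h3
    simp only [div_eq_inv_mul]
    rw [one_div] at h3
    rw [h3]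
    ring
  obtain ⟨e, he, hw⟩ := exists_unit_mul_norm (conj p.2 * p.1)
  have hq : ((e, 1) : ℂ × ℂ) ≠ 0 := by simp
  have hNq : pairNorm (e, 1) = 2 := by
    simp [pairNorm, he]
    norm_num
  have hN := pairNorm_pos hp
  have hle : ∀ ζ, |deviation p ζ| ≤ |deviation (e, 1) ζ| := by
    intro ζ
    have h1 : p.2 * conj p.1 = (‖conj p.2 * p.1‖ : ℂ) * conj e := by
      have := congrArg conj hw
      simpa only [map_mul, Complex.conj_conj, Complex.conj_ofReal] using this
    have h2 : deviation p ζ = 2 * ‖conj p.2 * p.1‖ / pairNorm p * deviation (e, 1) ζ := by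
      unfold deviation
      rw [h1, mul_assoc, Complex.re_ofReal_mul, hNq, one_mul]
      ring
    rw [h2, abs_mul]
    refine mul_le_of_le_one_left (abs_nonneg _) ?_
    rw [abs_of_nonneg (by positivity), div_le_one hN, norm_mul, Complex.norm_conj]
    unfold pairNorm
    nlinarith [sq_nonneg (‖p.1‖ - ‖p.2‖)]
  have hc := continuous_deviation p
  have hc' := continuous_deviation (e, 1)
  have h1 : Real.circleAverage (fun ζ => (1 - deviation p ζ) ^ n) 0 1
      ≤ Real.circleAverage (fun ζ => (1 - deviation (e, 1) ζ) ^ n) 0 1 := by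
    rw [hsym p, hsym (e, 1)]
    refine Real.circleAverage_mono (hint _ (by fun_prop)) (hint _ (by fun_prop)) fun ζ _ => ?_
    have := pow_add_pow_le (hle ζ) n
    linarith
  refine h1.trans (le_of_eq ?_)
  rw [← size_pow_linear n he, size_prod_eq_circleAverage, ← smul_eq_mul,
    ← Real.circleAverage_fun_smul]
  refine Real.circleAverage_congr_sphere fun ζ hζ => ?_
  have h2 := norm_sq_eq_deviation hq (norm_eq_one_of_mem_sphere hζ)
  simp only at h2
  simp only [h2, hNq, Finset.prod_const, Finset.card_univ, Fintype.card_fin, smul_eq_mul,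
    mul_pow, ← mul_assoc]
  simp

/-- `‖F‖ ≤ 2 ^ (-n) (2n choose n) ∏ (|αₖ|² + |βₖ|²)`. -/
theorem size_le_prod_pairNorm (hn : n ≠ 0) {p : Fin n → ℂ × ℂ} (hp : ∀ k, p k ≠ 0) :
    size (∏ k, linForm (p k))
      ≤ (2 : ℝ) ^ (-(n : ℤ)) * (2 * n).choose n * ∏ k, pairNorm (p k) := by
  have hint : ∀ f : ℂ → ℝ, Continuous f → CircleIntegrable f 0 1 := fun f hf =>
    hf.continuousOn.circleIntegrable zero_le_one
  have hn' : (n : ℝ) ≠ 0 := by exact_mod_cast hn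
  have hc := fun k => continuous_deviation (p k)
  have hP : 0 ≤ ∏ k, pairNorm (p k) := Finset.prod_nonneg fun k _ => (pairNorm_pos (hp k)).le
  rw [size_prod_eq_circleAverage]
  have h1 : Real.circleAverage (fun ζ => ∏ k, ‖(p k).2 * ζ - (p k).1‖ ^ 2) 0 1
      ≤ Real.circleAverage
        (fun ζ => ((∏ k, pairNorm (p k)) / n) • ∑ k, (1 - deviation (p k) ζ) ^ n) 0 1 := by
    refine Real.circleAverage_mono (hint _ (by fun_prop)) (hint _ (by fun_prop)) fun ζ hζ => ?_
    have hζ' := norm_eq_one_of_mem_sphere hζ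
    simp only [norm_sq_eq_deviation (hp _) hζ', Finset.prod_mul_distrib, smul_eq_mul]
    rw [div_mul_eq_mul_div, mul_div_assoc]
    refine mul_le_mul_of_nonneg_left (prod_le_mean_of_pow hn fun k => ?_) hP
    have := norm_sq_eq_deviation (hp k) hζ'
    have h2 : 0 ≤ pairNorm (p k) * (1 - deviation (p k) ζ) := this ▸ sq_nonneg _
    exact nonneg_of_mul_nonneg_right h2 (pairNorm_pos (hp k))
  refine h1.trans ?_
  rw [Real.circleAverage_fun_smul, Real.circleAverage_fun_sum fun k _ => hint _ (by fun_prop)]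
  have h2 := Finset.sum_le_card_nsmul Finset.univ _ _
    fun k _ => circleAverage_deviation_le (n := n) (hp k)
  rw [Finset.card_univ, Fintype.card_fin, nsmul_eq_mul] at h2
  rw [smul_eq_mul]
  refine (mul_le_mul_of_nonneg_left h2 (by positivity)).trans (le_of_eq ?_)
  field_simp

/-! ### The covariant of a stable form -/


/-- A family of nonzero vectors in which fewer than half of the members lie on any line. -/
def IsStableFamily (p : Fin n → ℂ × ℂ) : Prop :=
  (∀ k, p k ≠ 0) ∧ ∀ q : ℂ × ℂ, q ≠ 0 →
    2 * (Finset.univ.filter fun k => pairDet (p k) q = 0).card < n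

theorem linForm_dvd {p q : ℂ × ℂ} (hq : q ≠ 0) (h : pairDet p q = 0) : linForm q ∣ linForm p := by
  unfold pairDet at h
  have : ∃ c : ℂ, p = c • q := by
    by_cases h2 : q.2 = 0
    · have h1 : q.1 ≠ 0 := fun h1 => hq (Prod.ext h1 h2)
      have h3 : p.2 = 0 := by simpa [h2, h1] using h
      refine ⟨p.1 / q.1, Prod.ext ?_ ?_⟩
      · simp [h1]
      · simp [h2, h3]
    · refine ⟨p.2 / q.2, Prod.ext ?_ ?_⟩
      · simp only [Prod.smul_fst, smul_eq_mul]
        field_simp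
        linear_combination h
      · simp [h2]
  obtain ⟨c, rfl⟩ := this
  rw [linForm_smul]
  exact Dvd.intro_left _ rfl

theorem IsStable.isStableFamily {F : MvPolynomial (Fin 2) ℂ} (hF : IsStable n F)
    {p : Fin n → ℂ × ℂ} (hp : F = ∏ k, linForm (p k)) : IsStableFamily p := by
  constructor
  · intro k hk
    have hF0 : F = 0 := by
      rw [hp]
      exact Finset.prod_eq_zero (Finset.mem_univ k) (by simp [hk, linForm])
    -- The zero form is divisible by every power; multiplicity `n` would force `2 * n < n`.
    have := hF.2 (1, 0) (by simp) n (by rw [hF0]; exact dvd_zero _)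
    omega
  · intro q hq
    refine hF.2 q hq _ ?_
    rw [hp, ← Finset.prod_const]
    refine (Finset.prod_dvd_prod_of_dvd _ (fun k => linForm (p k)) fun k hk => ?_).trans
      (Finset.prod_dvd_prod_of_subset _ _ _ (Finset.subset_univ _))
    exact linForm_dvd hq (Finset.mem_filter.mp hk).2

theorem IsStableFamily.pull {p : Fin n → ℂ × ℂ} (hp : IsStableFamily p) (γ : SL(2, ℂ)) :
    IsStableFamily fun k => pullPair γ (p k) := by
  refine ⟨fun k => pullPair_ne_zero γ (hp.1 k), fun q hq => ?_⟩
  have h := hp.2 _ (pullPair_ne_zero γ⁻¹ hq)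
  have e : ∀ k, pairDet (pullPair γ (p k)) q
      = pairDet (p k) (pullPair γ⁻¹ q) := by
    intro k
    rw [← pairDet_pullPair γ (p k), pullPair_pullPair_inv]
  simpa only [e] using h

theorem IsStableFamily.pos {p : Fin n → ℂ × ℂ} (hp : IsStableFamily p) : n ≠ 0 := by
  have := hp.2 (1, 0) (by simp)
  omega

theorem IsStableFamily.card_lt {p : Fin n → ℂ × ℂ} (hp : IsStableFamily p)
    (ω : WithLp 2 (ℂ × ℝ)) :
    2 * (Finset.univ.filter fun k => spherePoint (p k) = ω).card < n := by
  rcases (Finset.univ.filter fun k => spherePoint (p k) = ω).eq_empty_or_nonempty with h | ⟨l, hl⟩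
  · rw [h]
    have := hp.pos
    simp
    omega
  · refine lt_of_le_of_lt (Nat.mul_le_mul_left 2 (Finset.card_le_card fun k hk => ?_))
      (hp.2 (p l) (hp.1 l))
    have h1 := (Finset.mem_filter.mp hl).2
    have h2 := (Finset.mem_filter.mp hk).2
    refine Finset.mem_filter.mpr ⟨Finset.mem_univ k, ?_⟩
    exact pairDet_eq_zero_of_spherePoint_eq (hp.1 k) (hp.1 l) (h2.trans h1.symm)

/-- Each of `ω` and `-ω` carries fewer than half of the points. -/
theorem IsStableFamily.exists_ne {p : Fin n → ℂ × ℂ} (hp : IsStableFamily p)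
    (ω : WithLp 2 (ℂ × ℝ)) : ∃ k, spherePoint (p k) ≠ ω ∧ spherePoint (p k) ≠ -ω := by
  by_contra! h
  have h1 := hp.card_lt ω
  have h2 := hp.card_lt (-ω)
  have h3 : (Finset.univ : Finset (Fin n)) ⊆
      (Finset.univ.filter fun k => spherePoint (p k) = ω) ∪
        Finset.univ.filter fun k => spherePoint (p k) = -ω := by
    intro k _
    by_cases hk : spherePoint (p k) = ω
    · simp [hk]
    · simp [h k hk]
  have h4 := (Finset.card_le_card h3).trans (Finset.card_union_le _ _)
  rw [Finset.card_univ, Fintype.card_fin] at h4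
  omega

theorem exists_growth_ge_of_card {p : Fin n → ℂ × ℂ} (hp : ∀ k, p k ≠ 0) (m : ℕ)
    (hm : ∀ ω, m + (Finset.univ.filter fun k => spherePoint (p k) = ω).card ≤ n) :
    ∃ c : ℝ, 0 < c ∧ ∀ ω : WithLp 2 (ℂ × ℝ), ‖ω‖ = 1 → ∀ s : ℝ, 0 ≤ s →
      c * Real.exp ((2 * m - n) * s) ≤ growth (fun k => spherePoint (p k)) ω s := by
  refine exists_growth_ge (fun k => norm_spherePoint (hp k)) m fun ω _ =>
    ⟨Finset.univ.filter fun k => spherePoint (p k) ≠ ω, ?_, by simp, by simp⟩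
  have h := Finset.card_filter_add_card_filter_not (s := (Finset.univ : Finset (Fin n)))
    (fun k => spherePoint (p k) = ω)
  rw [Finset.card_univ, Fintype.card_fin] at h
  have := hm ω
  simp only [ne_eq]
  omega

theorem IsStableFamily.exists_growth_ge_exp {p : Fin n → ℂ × ℂ} (hp : IsStableFamily p) :
    ∃ c : ℝ, 0 < c ∧ ∀ ω : WithLp 2 (ℂ × ℝ), ‖ω‖ = 1 → ∀ s : ℝ, 0 ≤ s →
      c * Real.exp s ≤ growth (fun k => spherePoint (p k)) ω s := by
  -- The least integer above half of `n`: it makes the exponent `2 * m - n` at least `1`.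
  obtain ⟨c, hc, h⟩ := exists_growth_ge_of_card hp.1 (n / 2 + 1) fun ω => by
    have := hp.card_lt ω
    omega
  refine ⟨c, hc, fun ω hω s hs => le_trans ?_ (h ω hω s hs)⟩
  refine mul_le_mul_of_nonneg_left (Real.exp_le_exp.mpr ?_) hc.le
  have h1 : n + 1 ≤ 2 * (n / 2 + 1) := by omega
  have h2 : (n : ℝ) + 1 ≤ 2 * ((n / 2 + 1 : ℕ) : ℝ) := by exact_mod_cast h1
  nlinarith

theorem R_polar {p : Fin n → ℂ × ℂ} (hp : ∀ k, p k ≠ 0) {ω : WithLp 2 (ℂ × ℝ)} (hω : ‖ω‖ = 1)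
    (s : ℝ) : R n (∏ k, linForm (p k)) (polar ω hω s)
      = (∏ k, pairNorm (p k)) * growth (fun k => spherePoint (p k)) ω s := by
  rw [R_prod, growth, ← Finset.prod_mul_distrib]
  exact Finset.prod_congr rfl fun k _ => hermForm_polar (hp k) hω s

theorem R_j (p : Fin n → ℂ × ℂ) : R n (∏ k, linForm (p k)) H3.j = ∏ k, pairNorm (p k) := by
  rw [R_prod]
  exact Finset.prod_congr rfl fun k _ => hermForm_j (p k)

theorem prod_pairNorm_pos {p : Fin n → ℂ × ℂ} (hp : ∀ k, p k ≠ 0) : 0 < ∏ k, pairNorm (p k) :=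
  Finset.prod_pos fun k _ => pairNorm_pos (hp k)

theorem R_polar_div {p : Fin n → ℂ × ℂ} (hp : ∀ k, p k ≠ 0) {ω : WithLp 2 (ℂ × ℝ)} (hω : ‖ω‖ = 1)
    (s : ℝ) : R n (∏ k, linForm (p k)) (polar ω hω s) / R n (∏ k, linForm (p k)) H3.j
      = growth (fun k => spherePoint (p k)) ω s := by
  rw [R_polar hp, R_j, mul_div_cancel_left₀ _ (prod_pairNorm_pos hp).ne']

theorem polar_zero {ω : WithLp 2 (ℂ × ℝ)} (hω : ‖ω‖ = 1) : polar ω hω 0 = H3.j := by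
  ext <;> simp [polar, H3.j]

/-- Beyond distance `1 / c` one has `c e^s ≥ c (s + 1) ≥ 1`, the value of `growth` at `j`. The
minimum over the compact ball is therefore global. -/
theorem IsStableFamily.exists_isMinOn {p : Fin n → ℂ × ℂ} (hp : IsStableFamily p) :
    ∃ z, IsMinOn (R n (∏ k, linForm (p k))) Set.univ z := by
  obtain ⟨c, hc, hlow⟩ := hp.exists_growth_ge_exp
  set φ := fun k => spherePoint (p k)
  have hd : 0 ≤ max 0 (1 / c) := le_max_left _ _
  obtain ⟨⟨ω₀, s₀⟩, ⟨hω₀, -⟩, hmin⟩ := ((isCompact_sphere (0 : WithLp 2 (ℂ × ℝ)) 1).prod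
    (isCompact_Icc (a := (0 : ℝ)) (b := max 0 (1 / c)))).exists_isMinOn
    (by obtain ⟨ω, hω⟩ := exists_unit
        exact ⟨(ω, 0), by simpa using hω, ⟨le_rfl, hd⟩⟩) (continuous_growth φ).continuousOn
  have hω₀' : ‖ω₀‖ = 1 := by simpa using hω₀
  have hmin' : ∀ ω : WithLp 2 (ℂ × ℝ), ‖ω‖ = 1 → ∀ s ∈ Set.Icc 0 (max 0 (1 / c)),
      growth φ ω₀ s₀ ≤ growth φ ω s := fun ω hω s hs =>
    hmin (show (ω, s) ∈ _ from ⟨by simpa using hω, hs⟩)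
  refine ⟨polar ω₀ hω₀' s₀, fun z _ => ?_⟩
  obtain ⟨ω, hω, hz⟩ := exists_polar z
  simp only [Set.mem_ofPred_eq]
  rw [hz, R_polar hp.1, R_polar hp.1]
  refine mul_le_mul_of_nonneg_left ?_ (prod_pairNorm_pos hp.1).le
  have hs := hdist_nonneg z H3.j
  rcases le_total (z.hdist H3.j) (max 0 (1 / c)) with h | h
  · exact hmin' ω hω _ ⟨hs, h⟩
  · have h1 := hmin' ω hω 0 ⟨le_rfl, hd⟩
    rw [growth_zero] at h1
    refine h1.trans (le_trans ?_ (hlow ω hω _ hs))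
    have h2 : 1 / c ≤ Real.exp (z.hdist H3.j) := by
      have h3 := Real.add_one_le_exp (z.hdist H3.j)
      have h4 := (le_max_right 0 (1 / c)).trans h
      linarith
    rwa [div_le_iff₀' hc] at h2

theorem sum_spherePoint_eq_zero {p : Fin n → ℂ × ℂ} (hp : ∀ k, p k ≠ 0)
    (hj : IsMinOn (R n (∏ k, linForm (p k))) Set.univ H3.j) : ∑ k, spherePoint (p k) = 0 := by
  refine sum_eq_zero_of_one_le_growth fun ω hω s => ?_
  rw [← R_polar_div hp hω, one_le_div₀]
  · exact hj (Set.mem_univ _)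
  · rw [R_j]
    exact prod_pairNorm_pos hp

theorem IsStableFamily.eq_j {p : Fin n → ℂ × ℂ} (hp : IsStableFamily p)
    (hj : IsMinOn (R n (∏ k, linForm (p k))) Set.univ H3.j) {z : H3}
    (hz : IsMinOn (R n (∏ k, linForm (p k))) Set.univ z) : z = H3.j := by
  have hsum := sum_spherePoint_eq_zero hp.1 hj
  obtain ⟨ω, hω, h⟩ := exists_polar z
  rcases (hdist_nonneg z H3.j).eq_or_lt with h0 | h0
  · rw [h, ← h0, polar_zero]
  · have h1 := strictMonoOn_growth (fun k => norm_spherePoint (hp.1 k)) hsum hω (hp.exists_ne ω)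
      (Set.self_mem_Ici) (Set.mem_Ici.mpr h0.le) h0
    have h2 : R n (∏ k, linForm (p k)) z ≤ R n (∏ k, linForm (p k)) H3.j := hz (Set.mem_univ _)
    rw [growth_zero, ← R_polar_div hp.1 hω, ← h, one_lt_div] at h1
    · linarith
    · rw [R_j]
      exact prod_pairNorm_pos hp.1

theorem isMinOn_R_act (p : Fin n → ℂ × ℂ) (γ : SL(2, ℂ)) (z : H3) :
    IsMinOn (R n (act (∏ k, linForm (p k)) γ)) Set.univ z ↔
      IsMinOn (R n (∏ k, linForm (p k))) Set.univ (H3.mobius γ z) := by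
  simp only [isMinOn_univ_iff, R_act]
  refine ⟨fun h w => ?_, fun h w => h _⟩
  have := h (H3.mobius γ⁻¹ w)
  rwa [mobius_mobius_inv] at this

theorem IsStableFamily.existsUnique_isMinOn {p : Fin n → ℂ × ℂ} (hp : IsStableFamily p) :
    ∃! z, IsMinOn (R n (∏ k, linForm (p k))) Set.univ z := by
  obtain ⟨z, hz⟩ := hp.exists_isMinOn
  refine ⟨z, hz, fun w hw => ?_⟩
  obtain ⟨γ, rfl⟩ := exists_mobius_j z
  rw [← mobius_mobius_inv γ w] at hw ⊢
  rw [← isMinOn_R_act, act_prod_linForm] at hz hw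
  rw [(hp.pull γ).eq_j hz hw]

theorem IsStableFamily.isMinOn_covariant {p : Fin n → ℂ × ℂ} (hp : IsStableFamily p) :
    IsMinOn (R n (∏ k, linForm (p k))) Set.univ (covariant n (∏ k, linForm (p k))) :=
  Classical.epsilon_spec hp.exists_isMinOn

theorem IsStableFamily.covariant_act {p : Fin n → ℂ × ℂ} (hp : IsStableFamily p)
    (γ : SL(2, ℂ)) : H3.mobius γ (covariant n (act (∏ k, linForm (p k)) γ))
      = covariant n (∏ k, linForm (p k)) := by
  refine hp.existsUnique_isMinOn.unique ?_ hp.isMinOn_covariant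
  rw [← isMinOn_R_act]
  rw [act_prod_linForm]
  exact (hp.pull γ).isMinOn_covariant

theorem IsStableFamily.covariant_act_eq_j_iff {p : Fin n → ℂ × ℂ} (hp : IsStableFamily p)
    (γ : SL(2, ℂ)) : covariant n (act (∏ k, linForm (p k)) γ) = H3.j ↔
      H3.mobius γ H3.j = covariant n (∏ k, linForm (p k)) := by
  rw [← hp.covariant_act γ]
  refine ⟨fun h => by rw [h], fun h => ?_⟩
  rw [← mobius_inv_mobius γ (covariant n _), ← h, mobius_inv_mobius]

theorem IsStableFamily.exists_covariant_act_eq_j {p : Fin n → ℂ × ℂ} (hp : IsStableFamily p) :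
    ∃ γ : SL(2, ℂ), covariant n (act (∏ k, linForm (p k)) γ) = H3.j := by
  obtain ⟨γ, hγ⟩ := exists_mobius_j (covariant n (∏ k, linForm (p k)))
  exact ⟨γ, (hp.covariant_act_eq_j_iff γ).mpr hγ⟩

theorem IsStableFamily.theta_pos {p : Fin n → ℂ × ℂ} (hp : IsStableFamily p) :
    0 < theta n (∏ k, linForm (p k)) := by
  rw [theta, R_prod]
  exact Finset.prod_pos fun k _ => hermForm_pos (hp.1 k) _

/-! ### The functions `ε_F` and `ε(F)` -/

/-- The values of `R(F₀, ·) / R(F₀, j)` at distance `δ` from `j`. -/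
theorem image_ratio_eq_image_growth {p : Fin n → ℂ × ℂ} (hp : ∀ k, p k ≠ 0) {δ : ℝ} (hδ : 0 ≤ δ) :
    (fun z => R n (∏ k, linForm (p k)) z / R n (∏ k, linForm (p k)) H3.j) ''
        {z | H3.hdist z H3.j = δ}
      = (fun ω => growth (fun k => spherePoint (p k)) ω δ) '' Metric.sphere 0 1 := by
  ext x
  constructor
  · rintro ⟨z, rfl, rfl⟩
    obtain ⟨ω, hω, h⟩ := exists_polar z
    refine ⟨ω, by simpa using hω, ?_⟩
    simp only
    conv_rhs => rw [h]
    rw [R_polar_div hp hω]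
  · rintro ⟨ω, hω, rfl⟩
    have hω' : ‖ω‖ = 1 := by simpa using hω
    exact ⟨polar ω hω' δ, hdist_polar hω' hδ, R_polar_div hp hω' δ⟩

theorem epsFun₀_eq_minGrowth {p : Fin n → ℂ × ℂ} (hp : ∀ k, p k ≠ 0) {δ : ℝ} (hδ : 0 ≤ δ) :
    epsFun₀ n (∏ k, linForm (p k)) δ = minGrowth (fun k => spherePoint (p k)) δ := by
  rw [epsFun₀, image_ratio_eq_image_growth hp hδ, minGrowth]

theorem hdist_mobius (γ : SL(2, ℂ)) (z w : H3) :
    H3.hdist (H3.mobius γ z) (H3.mobius γ w) = H3.hdist z w :=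
  hdist_eq_iff (coshDist_mobius γ z w)

/-- The values of `R(F₀, ·) / R(F₀, j)` at distance `δ` from `j` do not depend on `F₀`. -/
theorem IsStableFamily.image_ratio_act {p : Fin n → ℂ × ℂ} (hp : IsStableFamily p)
    {γ : SL(2, ℂ)} (hγ : covariant n (act (∏ k, linForm (p k)) γ) = H3.j) (δ : ℝ) :
    (fun z => R n (act (∏ k, linForm (p k)) γ) z / R n (act (∏ k, linForm (p k)) γ) H3.j) ''
        {z | H3.hdist z H3.j = δ}
      = (fun z => R n (∏ k, linForm (p k)) z / theta n (∏ k, linForm (p k))) ''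
        {z | H3.hdist z (covariant n (∏ k, linForm (p k))) = δ} := by
  have hj := (hp.covariant_act_eq_j_iff γ).mp hγ
  simp only [R_act, theta, ← hj]
  ext x
  constructor
  · rintro ⟨z, rfl, rfl⟩
    exact ⟨H3.mobius γ z, hdist_mobius γ _ _, rfl⟩
  · rintro ⟨z, rfl, rfl⟩
    refine ⟨H3.mobius γ⁻¹ z, ?_, by simp only [mobius_mobius_inv]⟩
    rw [Set.mem_ofPred_eq, ← hdist_mobius γ, mobius_mobius_inv]

/-- `ε(F₀)` as an infimum over the half-space. -/
theorem epsConst₀_eq (hn : 2 ≤ n) {p : Fin n → ℂ × ℂ} (hp : ∀ k, p k ≠ 0) :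
    epsConst₀ n (∏ k, linForm (p k)) = sInf (Set.range fun z : H3 =>
      R n (∏ k, linForm (p k)) z / R n (∏ k, linForm (p k)) H3.j
        / coshDist z H3.j ^ (n - 2)) := by
  -- The substitution is `φ = -ω`, `ρ = tanh s`; the factor `1 / (1 - ρ²) = cosh² s` lowers the
  -- power of `cosh s` from `n` to `n - 2`.
  have key : ∀ (ω : WithLp 2 (ℂ × ℝ)) (s : ℝ),
      (∏ k, (1 + inner ℝ (-ω) (spherePoint (p k)) * Real.tanh s)) / (1 - Real.tanh s ^ 2)
        = growth (fun k => spherePoint (p k)) ω s / Real.cosh s ^ (n - 2) := by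
    intro ω s
    have hc := (Real.cosh_pos s).ne'
    have h1 : growth (fun k => spherePoint (p k)) ω s
        = Real.cosh s ^ n * ∏ k, (1 + inner ℝ (-ω) (spherePoint (p k)) * Real.tanh s) := by
      have : Real.cosh s ^ n = ∏ _k : Fin n, Real.cosh s := by simp
      rw [growth, this, ← Finset.prod_mul_distrib]
      refine Finset.prod_congr rfl fun k _ => ?_
      rw [inner_neg_left, Real.tanh_eq_sinh_div_cosh]
      field_simp
      ring
    have h2 : 1 - Real.tanh s ^ 2 = (Real.cosh s ^ 2)⁻¹ := by
      rw [Real.tanh_eq_sinh_div_cosh]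
      field_simp
      linear_combination Real.cosh_sq s
    have h3 : Real.cosh s ^ n = Real.cosh s ^ (n - 2) * Real.cosh s ^ 2 := by
      rw [← pow_add, Nat.sub_add_cancel hn]
    rw [h1, h2, h3]
    generalize (∏ k : Fin n, _ : ℝ) = P
    field_simp
  unfold epsConst₀
  congr 1
  ext x
  simp only [prod_sphere_eq p hp, Set.mem_ofPred_eq, Set.mem_range]
  constructor
  · rintro ⟨ω, hω, ρ, hρ, rfl⟩
    have hω' : ‖-ω‖ = 1 := by simpa using hω
    refine ⟨polar (-ω) hω' (Real.artanh ρ), ?_⟩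
    rw [R_polar_div hp hω', coshDist_polar, ← key, neg_neg,
      Real.tanh_artanh ⟨by linarith [hρ.1], hρ.2⟩]
  · rintro ⟨z, rfl⟩
    obtain ⟨ω, hω, h⟩ := exists_polar z
    refine ⟨-ω, by simpa using hω, Real.tanh (z.hdist H3.j), ⟨?_, Real.tanh_lt_one _⟩, ?_⟩
    · rw [Real.tanh_eq_sinh_div_cosh]
      exact div_nonneg (Real.sinh_nonneg_iff.mpr (hdist_nonneg _ _)) (Real.cosh_pos _).le
    · rw [key, cosh_hdist, ← R_polar_div hp hω, ← h]

theorem IsStableFamily.epsConst₀_act (hn : 2 ≤ n) {p : Fin n → ℂ × ℂ} (hp : IsStableFamily p)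
    {γ : SL(2, ℂ)} (hγ : covariant n (act (∏ k, linForm (p k)) γ) = H3.j) :
    epsConst₀ n (act (∏ k, linForm (p k)) γ) = sInf (Set.range fun z : H3 =>
      R n (∏ k, linForm (p k)) z / theta n (∏ k, linForm (p k))
        / coshDist z (covariant n (∏ k, linForm (p k))) ^ (n - 2)) := by
  have hj := (hp.covariant_act_eq_j_iff γ).mp hγ
  rw [act_prod_linForm, epsConst₀_eq hn (hp.pull γ).1, ← act_prod_linForm]
  simp only [R_act, theta, ← hj]
  congr 1
  ext x
  constructor
  · rintro ⟨z, rfl⟩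
    exact ⟨H3.mobius γ z, by simp only [coshDist_mobius]⟩
  · rintro ⟨z, rfl⟩
    refine ⟨H3.mobius γ⁻¹ z, ?_⟩
    have : coshDist (H3.mobius γ⁻¹ z) H3.j = coshDist z (H3.mobius γ H3.j) := by
      rw [← coshDist_mobius γ, mobius_mobius_inv]
    simp only [mobius_mobius_inv, this]

theorem exists_normalized {p : Fin n → ℂ × ℂ} (hp : IsStableFamily p) :
    ∃ γ : SL(2, ℂ), covariant n (act (∏ k, linForm (p k)) γ) = H3.j ∧
      normalized n (∏ k, linForm (p k)) = act (∏ k, linForm (p k)) γ :=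
  ⟨_, Classical.epsilon_spec hp.exists_covariant_act_eq_j, rfl⟩

/-- A normalized form of `F` described by its linear factors. -/
theorem IsStableFamily.exists_normalized_family {p : Fin n → ℂ × ℂ} (hp : IsStableFamily p) :
    ∃ γ : SL(2, ℂ), covariant n (act (∏ k, linForm (p k)) γ) = H3.j ∧
      normalized n (∏ k, linForm (p k)) = act (∏ k, linForm (p k)) γ ∧
      (∑ k, spherePoint (pullPair γ (p k)) = 0) ∧
      ∀ δ, 0 ≤ δ → epsFun n (∏ k, linForm (p k)) δ
        = minGrowth (fun k => spherePoint (pullPair γ (p k))) δ := by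
  obtain ⟨γ, hγ, h⟩ := exists_normalized hp
  have hq := hp.pull γ
  refine ⟨γ, hγ, h, ?_, fun δ hδ => ?_⟩
  · refine sum_spherePoint_eq_zero hq.1 ?_
    rw [← act_prod_linForm, ← hγ, act_prod_linForm]
    exact hq.isMinOn_covariant
  · rw [epsFun, h, act_prod_linForm, epsFun₀_eq_minGrowth hq.1 hδ]

theorem IsStableFamily.isLeast_epsFun {p : Fin n → ℂ × ℂ} (hp : IsStableFamily p)
    {δ : ℝ} (hδ : 0 ≤ δ) :
    IsLeast ((fun z => R n (∏ k, linForm (p k)) z / theta n (∏ k, linForm (p k))) ''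
      {z | H3.hdist z (covariant n (∏ k, linForm (p k))) = δ})
      (epsFun n (∏ k, linForm (p k)) δ) := by
  obtain ⟨γ, hγ, -, -, h⟩ := hp.exists_normalized_family
  rw [← hp.image_ratio_act hγ, h δ hδ, act_prod_linForm,
    image_ratio_eq_image_growth (hp.pull γ).1 hδ]
  exact isLeast_minGrowth _ _

theorem IsStableFamily.strictMonoOn_epsFun {p : Fin n → ℂ × ℂ} (hp : IsStableFamily p) :
    StrictMonoOn (epsFun n (∏ k, linForm (p k))) (Set.Ici 0) := by
  obtain ⟨γ, -, -, hsum, h⟩ := hp.exists_normalized_family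
  have hq := hp.pull γ
  exact (strictMonoOn_minGrowth (fun k => norm_spherePoint (hq.1 k)) hsum
    fun ω _ => hq.exists_ne ω).congr fun δ hδ => (h δ hδ).symm

theorem IsStableFamily.bijOn_epsFun {p : Fin n → ℂ × ℂ} (hp : IsStableFamily p) :
    Set.BijOn (epsFun n (∏ k, linForm (p k))) (Set.Ici 0) (Set.Ici 1) := by
  obtain ⟨γ, -, -, hsum, h⟩ := hp.exists_normalized_family
  have hq := hp.pull γ
  obtain ⟨c, hc, hlow⟩ := hq.exists_growth_ge_exp
  exact (bijOn_minGrowth (strictMonoOn_minGrowth (fun k => norm_spherePoint (hq.1 k)) hsum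
    fun ω _ => hq.exists_ne ω) hc hlow).congr fun δ hδ => (h δ hδ).symm

/-! ### Bounds for the size along the orbit. -/

theorem IsStableFamily.epsFun_le {p : Fin n → ℂ × ℂ} (hp : IsStableFamily p) (z : H3) :
    epsFun n (∏ k, linForm (p k)) (z.hdist (covariant n (∏ k, linForm (p k))))
      ≤ R n (∏ k, linForm (p k)) z / theta n (∏ k, linForm (p k)) :=
  (hp.isLeast_epsFun (hdist_nonneg _ _)).2 ⟨z, rfl, rfl⟩

theorem IsStableFamily.R_div_theta_le {p : Fin n → ℂ × ℂ} (hp : IsStableFamily p) (z : H3) :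
    R n (∏ k, linForm (p k)) z / theta n (∏ k, linForm (p k))
      ≤ Real.cosh (z.hdist (covariant n (∏ k, linForm (p k)))) ^ n := by
  obtain ⟨γ, hγ, -, hsum, -⟩ := hp.exists_normalized_family
  have hq := hp.pull γ
  have h1 := hp.image_ratio_act hγ (z.hdist (covariant n (∏ k, linForm (p k))))
  rw [act_prod_linForm, image_ratio_eq_image_growth hq.1 (hdist_nonneg _ _)] at h1
  obtain ⟨ω, hω, h2⟩ := h1.symm.subset ⟨z, rfl, rfl⟩
  refine h2.symm.le.trans ?_
  exact growth_le_cosh_pow hp.pos (fun k => norm_spherePoint (hq.1 k)) hsum (by simpa using hω) _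

theorem hdist_mobius_inv (γ : SL(2, ℂ)) (z w : H3) :
    H3.hdist (H3.mobius γ⁻¹ z) w = H3.hdist (H3.mobius γ w) z := by
  rw [← hdist_mobius γ, mobius_mobius_inv]
  exact hdist_eq_iff (coshDist_comm _ _)

/-- The lower bound for the size of a form in the orbit of `F`. -/
theorem IsStableFamily.epsFun_le_size_act {p : Fin n → ℂ × ℂ} (hp : IsStableFamily p)
    (γ : SL(2, ℂ)) :
    2 * (epsFun n (∏ k, linForm (p k))
        (H3.hdist (H3.mobius γ⁻¹ (covariant n (∏ k, linForm (p k)))) H3.j)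
        * theta n (∏ k, linForm (p k)))
      ≤ 2 ^ n * size (act (∏ k, linForm (p k)) γ) := by
  -- At `γj` the value of `R(F, ·)` is `R(F·γ, j)`, the product of norms bounded by the size of
  -- `F·γ`.
  have h1 := hp.epsFun_le (H3.mobius γ H3.j)
  rw [le_div_iff₀ hp.theta_pos, ← R_act, act_prod_linForm, R_j] at h1
  have h2 := prod_pairNorm_le_size hp.pos fun k => pullPair γ (p k)
  rw [hdist_mobius_inv, act_prod_linForm]
  linarith

theorem act_one (p : Fin n → ℂ × ℂ) : act (∏ k, linForm (p k)) 1 = ∏ k, linForm (p k) := by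
  rw [act_prod_linForm]
  simp [pullPair]

theorem mobius_one (z : H3) : H3.mobius 1 z = z :=
  hermForm_ext fun p => by
    rw [hermForm_mobius]
    simp [pullPair]

theorem IsStableFamily.epsFun_le_size {p : Fin n → ℂ × ℂ} (hp : IsStableFamily p) :
    (2 : ℝ) ^ (1 - (n : ℤ)) * epsFun n (∏ k, linForm (p k))
        (H3.hdist (covariant n (∏ k, linForm (p k))) H3.j)
      ≤ size (∏ k, linForm (p k)) / theta n (∏ k, linForm (p k)) := by
  have h := hp.epsFun_le_size_act 1
  rw [inv_one, mobius_one, act_one] at h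
  rw [le_div_iff₀ hp.theta_pos, zpow_sub₀ two_ne_zero, zpow_one, zpow_natCast, mul_assoc,
    div_mul_eq_mul_div, div_le_iff₀ (by positivity)]
  linarith

theorem IsStableFamily.size_le {p : Fin n → ℂ × ℂ} (hp : IsStableFamily p) :
    size (∏ k, linForm (p k)) / theta n (∏ k, linForm (p k))
      ≤ (2 : ℝ) ^ (-(n : ℤ)) * ((2 * n).choose n : ℝ) *
        Real.cosh (H3.hdist (covariant n (∏ k, linForm (p k))) H3.j) ^ n := by
  have h1 := hp.R_div_theta_le H3.j
  have h2 := size_le_prod_pairNorm hp.pos hp.1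
  rw [← R_j] at h2
  rw [hdist_eq_iff (coshDist_comm _ _)] at h1
  refine (div_le_div_of_nonneg_right h2 hp.theta_pos.le).trans ?_
  rw [mul_div_assoc]
  exact mul_le_mul_of_nonneg_left h1 (by positivity)

/-- At the distance from `γ⁻¹z(F)` to `j`, monotonicity puts `ε_F` above `2^(n-1) ‖F‖ / θ`, while
`epsFun_le_size_act` keeps it at most `2^(n-1) ‖F·γ‖ / θ`. -/
theorem IsStableFamily.size_lt_of_epsFunInv {p : Fin n → ℂ × ℂ} (hp : IsStableFamily p)
    (γ : SL(2, ℂ))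
    (h : Real.cosh (epsFunInv n (∏ k, linForm (p k))
        (2 ^ (n - 1) * (size (∏ k, linForm (p k)) / theta n (∏ k, linForm (p k)))))
      < coshDist (H3.mobius γ⁻¹ (covariant n (∏ k, linForm (p k)))) H3.j) :
    size (∏ k, linForm (p k)) < size (act (∏ k, linForm (p k)) γ) := by
  have h1 := hp.epsFun_le_size
  have h2 := hp.epsFun_le_size_act γ
  have hpow : (2 : ℝ) ^ n = 2 ^ (n - 1) * 2 := by
    rw [← pow_succ, Nat.sub_add_cancel (Nat.pos_of_ne_zero hp.pos)]
  have hθ := hp.theta_pos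
  set F := ∏ k, linForm (p k)
  set y := (2 : ℝ) ^ (n - 1) * (size F / theta n F) with hy
  -- Needed for `y` to lie in the range of `ε_F`, so that `epsFunInv` returns a true preimage.
  have hy1 : 1 ≤ y := by
    have h3 : 1 ≤ epsFun n F (H3.hdist (covariant n F) H3.j) :=
      hp.bijOn_epsFun.mapsTo (hdist_nonneg _ _)
    refine h3.trans ?_
    rw [zpow_sub₀ two_ne_zero, zpow_one, zpow_natCast, hpow, div_mul_eq_mul_div,
      div_le_iff₀ (by positivity)] at h1
    rw [hy]
    linarith
  have hmem : epsFunInv n F y ∈ Set.Ici 0 ∧ epsFun n F (epsFunInv n F y) = y :=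
    Function.invFunOn_pos (hp.bijOn_epsFun.surjOn hy1)
  rw [← cosh_hdist, Real.cosh_lt_cosh, abs_of_nonneg hmem.1, abs_of_nonneg (hdist_nonneg _ _)] at h
  have h4 := hp.strictMonoOn_epsFun hmem.1 (Set.mem_Ici.mpr (hdist_nonneg _ _)) h
  rw [hmem.2, hy, mul_div_assoc', div_lt_iff₀ hθ] at h4
  rw [hpow] at h2
  have h5 : (0 : ℝ) < 2 ^ (n - 1) := by positivity
  nlinarith

/-! ### Squarefree forms -/

theorem pairDet_ne_zero_of_squarefree {p : Fin n → ℂ × ℂ} (hp : ∀ k, p k ≠ 0)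
    (hF : Squarefree (∏ k, linForm (p k))) {k l : Fin n} (hkl : k ≠ l) :
    pairDet (p k) (p l) ≠ 0 := by
  intro h
  have h1 : linForm (p l) * linForm (p l) ∣ ∏ k, linForm (p k) := by
    refine (mul_dvd_mul (linForm_dvd (hp l) h) dvd_rfl).trans ?_
    rw [← Finset.prod_pair (f := fun k => linForm (p k)) hkl]
    exact Finset.prod_dvd_prod_of_subset _ _ _ (Finset.subset_univ _)
  -- A repeated linear form would be a unit, yet it vanishes at its own root `(α, β)`.
  have h2 := (hF _ h1).map (MvPolynomial.eval ![(p l).1, (p l).2])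
  simp [linForm] at h2
  exact h2 (by ring)

/-- The sphere points are distinct, so at least `n - 1` factors grow in each direction and the
exponent is `2(n - 1) - n = n - 2`; finally `e^s ≥ cosh s`. -/
theorem exists_growth_ge_of_squarefree (hn : 2 ≤ n) {p : Fin n → ℂ × ℂ} (hp : ∀ k, p k ≠ 0)
    (hdet : ∀ k l, k ≠ l → pairDet (p k) (p l) ≠ 0) :
    ∃ c : ℝ, 0 < c ∧ ∀ ω : WithLp 2 (ℂ × ℝ), ‖ω‖ = 1 → ∀ s : ℝ, 0 ≤ s →
      c * Real.cosh s ^ (n - 2) ≤ growth (fun k => spherePoint (p k)) ω s := by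
  obtain ⟨c, hc, h⟩ := exists_growth_ge_of_card hp (n - 1) fun ω => by
    have : (Finset.univ.filter fun k => spherePoint (p k) = ω).card ≤ 1 := by
      refine Finset.card_le_one.mpr fun k hk l hl => ?_
      by_contra hkl
      refine hdet k l hkl (pairDet_eq_zero_of_spherePoint_eq (hp k) (hp l) ?_)
      rw [(Finset.mem_filter.mp hk).2, (Finset.mem_filter.mp hl).2]
    omega
  refine ⟨c, hc, fun ω hω s hs => le_trans ?_ (h ω hω s hs)⟩
  refine mul_le_mul_of_nonneg_left ?_ hc.le
  have h1 : (2 * ((n - 1 : ℕ) : ℝ) - n) * s = ((n - 2 : ℕ) : ℝ) * s := by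
    rw [Nat.cast_sub (by omega), Nat.cast_sub hn]
    push_cast
    ring
  rw [h1, Real.exp_nat_mul]
  refine pow_le_pow_left₀ (Real.cosh_pos s).le ?_ _
  rw [← Real.cosh_add_sinh]
  linarith [Real.sinh_nonneg_iff.mpr hs]

theorem IsStableFamily.epsConst_eq (hn : 2 ≤ n) {p : Fin n → ℂ × ℂ} (hp : IsStableFamily p) :
    epsConst n (∏ k, linForm (p k)) = sInf (Set.range fun z : H3 =>
      R n (∏ k, linForm (p k)) z / theta n (∏ k, linForm (p k))
        / coshDist z (covariant n (∏ k, linForm (p k))) ^ (n - 2)) := by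
  obtain ⟨γ, hγ, h⟩ := exists_normalized hp
  rw [epsConst, h, hp.epsConst₀_act hn hγ]

theorem IsStableFamily.epsConst_pos (hn : 2 ≤ n) {p : Fin n → ℂ × ℂ} (hp : IsStableFamily p)
    (hF : Squarefree (∏ k, linForm (p k))) : 0 < epsConst n (∏ k, linForm (p k)) := by
  obtain ⟨γ, hγ, h⟩ := exists_normalized hp
  have hq := hp.pull γ
  obtain ⟨c, hc, hlow⟩ := exists_growth_ge_of_squarefree hn hq.1 fun k l hkl => by
    rw [pairDet_pullPair]
    exact pairDet_ne_zero_of_squarefree hp.1 hF hkl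
  rw [epsConst, h, act_prod_linForm, epsConst₀_eq hn hq.1]
  refine hc.trans_le (le_csInf (Set.range_nonempty _) ?_)
  rintro _ ⟨z, rfl⟩
  obtain ⟨ω, hω, hz⟩ := exists_polar z
  simp only
  rw [← cosh_hdist, le_div_iff₀ (pow_pos (Real.cosh_pos _) _)]
  conv_rhs => rw [hz]
  rw [R_polar_div hq.1 hω]
  exact hlow ω hω _ (hdist_nonneg _ _)

theorem IsStableFamily.epsConst_mul_le (hn : 2 ≤ n) {p : Fin n → ℂ × ℂ} (hp : IsStableFamily p)
    (z : H3) : epsConst n (∏ k, linForm (p k))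
        * coshDist z (covariant n (∏ k, linForm (p k))) ^ (n - 2)
      ≤ R n (∏ k, linForm (p k)) z / theta n (∏ k, linForm (p k)) := by
  have hc : ∀ z, 0 < coshDist z (covariant n (∏ k, linForm (p k))) := fun z =>
    one_pos.trans_le (one_le_coshDist _ _)
  rw [hp.epsConst_eq hn, ← le_div_iff₀ (pow_pos (hc z) _)]
  refine csInf_le ⟨0, ?_⟩ ⟨z, rfl⟩
  rintro _ ⟨w, rfl⟩
  refine div_nonneg (div_nonneg ?_ hp.theta_pos.le) (pow_pos (hc w) _).le
  rw [R_prod]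
  exact Finset.prod_nonneg fun k _ => (hermForm_pos (hp.1 k) _).le

theorem size_nonneg (F : MvPolynomial (Fin 2) ℂ) : 0 ≤ size F :=
  Finset.sum_nonneg fun _ _ => sq_nonneg _

theorem IsStableFamily.size_lt_of_squarefree (hn : 3 ≤ n) {p : Fin n → ℂ × ℂ}
    (hp : IsStableFamily p) (hF : Squarefree (∏ k, linForm (p k))) (γ : SL(2, ℂ))
    (h : 2 * (2 * size (∏ k, linForm (p k)) / (epsConst n (∏ k, linForm (p k))
        * theta n (∏ k, linForm (p k)))) ^ (1 / ((n : ℝ) - 2))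
      < coshDist (H3.mobius γ⁻¹ (covariant n (∏ k, linForm (p k)))) H3.j) :
    size (∏ k, linForm (p k)) < size (act (∏ k, linForm (p k)) γ) := by
  have hε := hp.epsConst_pos (by omega) hF
  have hθ := hp.theta_pos
  have h1 := hp.epsConst_mul_le (by omega) (H3.mobius γ H3.j)
  rw [le_div_iff₀ hθ, ← R_act, act_prod_linForm, R_j] at h1
  have h2 := prod_pairNorm_le_size hp.pos fun k => pullPair γ (p k)
  rw [← act_prod_linForm] at h2
  have hd : coshDist (H3.mobius γ⁻¹ (covariant n (∏ k, linForm (p k)))) H3.j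
      = coshDist (H3.mobius γ H3.j) (covariant n (∏ k, linForm (p k))) := by
    rw [← cosh_hdist, ← cosh_hdist, hdist_mobius_inv]
  rw [hd] at h
  have hs := size_nonneg (∏ k, linForm (p k))
  have hpow : (2 : ℝ) ^ n = 2 ^ (n - 2) * 4 := by
    have : n = n - 2 + 2 := by omega
    conv_lhs => rw [this, pow_add]
    norm_num
  set F := ∏ k, linForm (p k)
  set C := coshDist (H3.mobius γ H3.j) (covariant n F)
  set X := 2 * size F / (epsConst n F * theta n F) with hX
  have hX0 : 0 ≤ X := by positivity
  have hn2 : n - 2 ≠ 0 := by omega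
  have he : 1 / ((n : ℝ) - 2) = ((n - 2 : ℕ) : ℝ)⁻¹ := by
    rw [Nat.cast_sub (by omega), one_div, Nat.cast_ofNat]
  rw [he] at h
  -- The power `n - 2` turns the hypothesis into `2^(n-1) ‖F‖ < ε(F) θ C^(n-2)`. The right side is
  -- at most `R(F·γ, j) ≤ 2^(n-1) ‖F·γ‖`, so the constants match exactly.
  have h3 := pow_lt_pow_left₀ h (by positivity) hn2
  rw [mul_pow, Real.rpow_inv_natCast_pow hX0 hn2, hX, mul_div_assoc',
    div_lt_iff₀ (by positivity)] at h3
  rw [hpow] at h2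
  have h4 : (0 : ℝ) < 2 ^ (n - 2) := by positivity
  have h5 : 2 ^ (n - 2) * 4 * size F < 2 ^ (n - 2) * 4 * size (act F γ) := by linarith
  exact lt_of_mul_lt_mul_left h5 (by positivity)

end

end BinaryForm

theorem theorem4p5 (n : ℕ) (hn : 3 ≤ n) (F : MvPolynomial (Fin 2) ℂ)
    (hF : IsStable n F) :
    -- the objects in the statement are well defined
    (∃! z : H3, IsMinOn (R n F) Set.univ z) ∧
    0 < theta n F ∧
    (∃ γ : SL(2, ℂ), covariant n (act F γ) = H3.j) ∧
    (∀ γ : SL(2, ℂ), covariant n (act F γ) = H3.j → ∀ δ : ℝ, 0 ≤ δ →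
      IsLeast ((fun z => R n (act F γ) z / R n (act F γ) H3.j) '' {z | H3.hdist z H3.j = δ})
        (epsFun n F δ)) ∧
    StrictMonoOn (epsFun n F) (Set.Ici 0) ∧
    Set.BijOn (epsFun n F) (Set.Ici 0) (Set.Ici 1) ∧
    -- the bounds for `‖F‖ / θ(F)`
    (2 : ℝ) ^ (1 - (n : ℤ)) *
        epsFun n F (H3.hdist (covariant n F) H3.j)
      ≤ size F / theta n F ∧
    size F / theta n F
      ≤ (2 : ℝ) ^ (-(n : ℤ)) * ((2 * n).choose n : ℝ) *
        Real.cosh (H3.hdist (covariant n F) H3.j) ^ n ∧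
    -- the size of transformed forms
    (∀ (γ : SL(2, ℂ)) (w : H3),
      H3.mobius γ⁻¹ (covariant n F) = w →
      Real.cosh (epsFunInv n F
          (2 ^ (n - 1) * (size F / theta n F)))
        < (‖w.t‖ ^ 2 + w.u ^ 2 + 1) / (2 * w.u) →
      size F < size (act F γ)) ∧
    -- the variant for squarefree forms
    (Squarefree F →
      0 < epsConst n F ∧
      (∀ γ : SL(2, ℂ), covariant n (act F γ) = H3.j →
        epsConst n F = epsConst₀ n (act F γ)) ∧
      ∀ (γ : SL(2, ℂ)) (w : H3),
        H3.mobius γ⁻¹ (covariant n F) = w →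
        2 * (2 * size F / (epsConst n F * theta n F))
            ^ (1 / ((n : ℝ) - 2))
          < (‖w.t‖ ^ 2 + w.u ^ 2 + 1) / (2 * w.u) →
        size F < size (act F γ)) := by
  obtain ⟨p, rfl⟩ := exists_factors (by omega) hF.1
  have hp := hF.isStableFamily rfl
  refine ⟨hp.existsUnique_isMinOn, hp.theta_pos, hp.exists_covariant_act_eq_j,
    fun γ hγ δ hδ => ?_, hp.strictMonoOn_epsFun, hp.bijOn_epsFun, hp.epsFun_le_size, hp.size_le,
    ?_, fun hsq => ⟨hp.epsConst_pos (by omega) hsq, fun γ hγ => ?_, ?_⟩⟩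
  · rw [hp.image_ratio_act hγ]
    exact hp.isLeast_epsFun hδ
  · rintro γ w rfl h
    rw [← coshDist_j] at h
    exact hp.size_lt_of_epsFunInv γ h
  · rw [hp.epsConst_eq (by omega), hp.epsConst₀_act (by omega) hγ]
  · rintro γ w rfl h
    rw [← coshDist_j] at h
    exact hp.size_lt_of_squarefree hn hsq γ h
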